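/- Let $(X,d,\mu)$ be a metric measure space, i.e. $d$ is a complete separable length metric on $X$ and $\mu$ is a locally finite Borel measure on $X$ with full support. Let $n\ge 2$ be an integer and $\kappa\ge 0$ a real number; $B_r(x)$ denotes the closed $r$-ball. Assume: (1) ($n$-dimensional condition) $\displaystyle\lim_{r\to 0^+}\frac{\mu(B_r(x))}{\mathrm{vol}(B_r(\mathbf R^n))}=1$ for every $x\in X$, where $B_r(\mathbf R^n)$ is the closed $r$-ball of Euclidean $\mathbf R^n$. (2) (curvature-dimension condition $\mathrm{CD}(\kappa,n)$ in the sense of Sturm) Let $P_2(X,d,\mu)$ be the set of $\mu$-absolutely continuous Borel probability measures on $X$ with finite second moment, with the $L^2$-Wasserstein distance. For all $\nu_0=\rho_0\mu$ and $\nu_1=\rho_1\mu$ in $P_2(X,d,\mu)$ there are an optimal coupling $q$ of $\nu_0,\nu_1$ (for the cost $d^2$) and a constant speed minimal geodesic $(\nu_t)_{t\in[0,1]}$, $\nu_t=\rho_t\mu$, in $P_2(X,d,\mu)$ from $\nu_0$ to $\nu_1$ such that for all $t\in[0,1]$ and all real $N'\ge n$ $$-\int_X\rho_t^{-1/N'}\,d\nu_t\le-\int_{X\times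 X}\Big[\tau^{(1-t)}_{\kappa,N'}(d(x_0,x_1))\,\rho_0(x_0)^{-1/N'}+\tau^{(t)}_{\kappa,N'}(d(x_0,x_1))\,\rho_1(x_1)^{-1/N'}\Big]dq(x_0,x_1),$$ where $\tau^{(t)}_{\kappa,N'}(\theta)=t$ if $\kappa\theta^2=0$, $\tau^{(t)}_{\kappa,N'}(\theta)=t^{1/N'}\Big(\frac{\sin(t\theta\sqrt{\kappa/(N'-1)})}{\sin(\theta\sqrt{\kappa/(N'-1)})}\Big)^{1-1/N'}$ if $0<\kappa\theta^2<(N'-1)\pi^2$, and $\tau^{(t)}_{\kappa,N'}(\theta)=\infty$ if $\kappa\theta^2\ge(N'-1)\pi^2>0$. Then the $n$-volumic scalar curvature of $X$ satisfies $\mathrm{Sc}^{\mathrm{vol}_n}(X)\ge n\kappa$. That is: - if $\kappa=0$, there is $r>0$ such that $\mu(B_\epsilon(x))\le\mathrm{vol}(B_\epsilon(\mathbf R^n))$ for all $x\in X$ and $0<\epsilon\le r$; - if $\kappa>0$, then for every $\gamma>\sqrt{2/(n\kappa)}$ there is $r>0$ such that $\mu(B_\epsilon(x))<\mathrm{vol}(B_\epsilon(y))$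 for all $x\in X$, all $y\in S^2(\gamma)\times\mathbf R^{n-2}$ and all $0<\epsilon\le r$, where $S^2(\gamma)$ is the round $2$-sphere of radius $\gamma$ with its geodesic distance $d_S$ and area measure, and $S^2(\gamma)\times\mathbf R^{n-2}$ carries the distance $\sqrt{d_S^2+d_E^2}$, with $d_E$ the Euclidean distance, and the product measure. -/

import Mathlib

open MeasureTheory Filter Topology Set
open scoped ENNReal

noncomputable section

namespace VolumicScalar

/-- `d` is a length metric: the distance of any two points is the infimum of the lengths of the
continuous curves that join them. -/
def IsLengthMetric (X : Type*) [MetricSpace X] : Prop :=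
  ∀ x y : X, edist x y = ⨅ γ : Path x y, eVariationOn (fun t => γ t) univ

/-! ### The `L²`-Wasserstein space -/

section Wasserstein

variable {X : Type*} [MetricSpace X] [MeasurableSpace X]

/-- `q` is a coupling of `ν₀` and `ν₁`. -/
def IsCoupling (q : Measure (X × X)) (ν₀ ν₁ : Measure X) : Prop :=
  q.map Prod.fst = ν₀ ∧ q.map Prod.snd = ν₁

/-- The quadratic cost `∫ d(x₀, x₁)² dq(x₀, x₁)` of a transport plan. -/
def cost (q : Measure (X × X)) : ℝ≥0∞ :=
  ∫⁻ p, edist p.1 p.2 ^ 2 ∂q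

/-- The `L²`-Wasserstein distance. -/
def W2 (ν₀ ν₁ : Measure X) : ℝ≥0∞ :=
  (⨅ q : {q : Measure (X × X) // IsCoupling q ν₀ ν₁}, cost q.1) ^ (1 / 2 : ℝ)

/-- `q` is an optimal coupling of `ν₀` and `ν₁` for the quadratic cost. -/
def IsOptimalCoupling (q : Measure (X × X)) (ν₀ ν₁ : Measure X) : Prop :=
  IsCoupling q ν₀ ν₁ ∧ ∀ q' : Measure (X × X), IsCoupling q' ν₀ ν₁ → cost q ≤ cost q'

/-- `ν ∈ P₂(X, d, μ)`: a probability measure with finite second moment that is absolutely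
continuous with respect to `μ`. -/
def MemP2 (μ ν : Measure X) : Prop :=
  IsProbabilityMeasure ν ∧ (∃ o : X, ∫⁻ x, edist o x ^ 2 ∂ν < ∞) ∧ ν ≪ μ

/-- `Γ`, restricted to `[0, 1]`, is a constant speed minimal geodesic from `ν₀` to `ν₁` in
`P₂(X, d, μ)` with the Wasserstein distance. -/
def IsW2Geodesic (μ : Measure X) (Γ : ℝ → Measure X) (ν₀ ν₁ : Measure X) : Prop :=
  Γ 0 = ν₀ ∧ Γ 1 = ν₁ ∧ (∀ t ∈ Icc (0 : ℝ) 1, MemP2 μ (Γ t)) ∧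
    ∀ s ∈ Icc (0 : ℝ) 1, ∀ t ∈ Icc (0 : ℝ) 1,
      W2 (Γ s) (Γ t) = ENNReal.ofReal |s - t| * W2 ν₀ ν₁

end Wasserstein

/-! ### The curvature-dimension condition -/

/-- The volume distortion coefficient `τ_{K,N}^{(t)}(θ)`, for `N ≥ 1`, `t ∈ [0, 1]`, `θ ≥ 0`. -/
def tau (K N t θ : ℝ) : ℝ≥0∞ :=
  if K * θ ^ 2 = 0 then ENNReal.ofReal t
  else if 0 < K * θ ^ 2 then
    if (N - 1) * Real.pi ^ 2 ≤ K * θ ^ 2 then ∞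
    else ENNReal.ofReal (t ^ (1 / N) *
      (Real.sin (t * θ * √(K / (N - 1))) / Real.sin (θ * √(K / (N - 1)))) ^ (1 - 1 / N))
  else if N = 1 then ENNReal.ofReal t
  else ENNReal.ofReal (t ^ (1 / N) *
      (Real.sinh (t * θ * √(-K / (N - 1))) / Real.sinh (θ * √(-K / (N - 1)))) ^ (1 - 1 / N))

/-- The quantity `∫ ρ^{-1/N} dν` with `ρ = dν/dμ`, for `ν` absolutely continuous with respect to
`μ`. It is minus the Rényi entropy `S_N(ν | μ)`. -/
def negRenyi {X : Type*} [MeasurableSpace X] (N : ℝ) (ν μ : Measure X) : ℝ≥0∞ :=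
  ∫⁻ x, (ν.rnDeriv μ x) ^ (-1 / N) ∂ν

/-- The curvature-dimension condition `CD(K, N)` (Sturm). Both sides of the entropy inequality
are multiplied by `-1`, so that they are integrals of nonnegative functions. -/
def CD {X : Type*} [MetricSpace X] [MeasurableSpace X] (K N : ℝ) (μ : Measure X) : Prop :=
  ∀ ν₀ ν₁ : Measure X, MemP2 μ ν₀ → MemP2 μ ν₁ →
    ∃ (q : Measure (X × X)) (Γ : ℝ → Measure X),
      IsOptimalCoupling q ν₀ ν₁ ∧ IsW2Geodesic μ Γ ν₀ ν₁ ∧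
      ∀ t ∈ Icc (0 : ℝ) 1, ∀ N' : ℝ, N ≤ N' →
        ∫⁻ p, (tau K N' (1 - t) (dist p.1 p.2) * (ν₀.rnDeriv μ p.1) ^ (-1 / N') +
            tau K N' t (dist p.1 p.2) * (ν₁.rnDeriv μ p.2) ^ (-1 / N')) ∂q
          ≤ negRenyi N' (Γ t) μ

/-! ### Volumes of balls in the model spaces -/

/-- The volume of the closed `r`-ball in the Euclidean space `ℝⁿ`. -/
def euclideanBallVol (n : ℕ) (r : ℝ) : ℝ≥0∞ :=
  volume (Metric.closedBall (0 : EuclideanSpace ℝ (Fin n)) r)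

/-- The underlying set of the round sphere `S²(γ)`: its points are represented by their directions,
i.e. by points of the unit sphere of `ℝ³`. -/
abbrev S2 : Type := Metric.sphere (0 : EuclideanSpace ℝ (Fin 3)) 1

/-- The geodesic distance of the round sphere of radius `γ`. -/
def distS (γ : ℝ) (x y : S2) : ℝ :=
  γ * InnerProductGeometry.angle (x : EuclideanSpace ℝ (Fin 3)) (y : EuclideanSpace ℝ (Fin 3))

/-- The area measure of the round sphere of radius `γ`. -/
def volS (γ : ℝ) : Measure S2 :=
  ENNReal.ofReal (γ ^ 2) • (volume : Measure (EuclideanSpace ℝ (Fin 3))).toSphere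

/-- The Pythagorean product distance of `S²(γ) × ℝᵐ`. -/
def distSE (γ : ℝ) {m : ℕ} (p q : S2 × EuclideanSpace ℝ (Fin m)) : ℝ :=
  √(distS γ p.1 q.1 ^ 2 + dist p.2 q.2 ^ 2)

/-- The product volume of `S²(γ) × ℝᵐ`. -/
def volSE (γ : ℝ) (m : ℕ) : Measure (S2 × EuclideanSpace ℝ (Fin m)) :=
  (volS γ).prod volume

/-- The closed `r`-ball with centre `y` in `S²(γ) × ℝᵐ`. -/
def ballSE (γ : ℝ) {m : ℕ} (y : S2 × EuclideanSpace ℝ (Fin m)) (r : ℝ) :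
    Set (S2 × EuclideanSpace ℝ (Fin m)) :=
  {p | distSE γ p y ≤ r}

/-! ### The `n`-dimensional condition and the `n`-volumic scalar curvature -/

section Volumic

variable {X : Type*} [MetricSpace X] [MeasurableSpace X]

/-- The `n`-dimensional condition. -/
def NDimensional (n : ℕ) (μ : Measure X) : Prop :=
  ∀ x : X, Tendsto (fun r : ℝ => μ (Metric.closedBall x r) / euclideanBallVol n r)
    (𝓝[>] 0) (𝓝 1)

/-- `Sc^{vol_n}(X) ≥ 0`: all sufficiently small balls (uniformly in the centre) have measure at
most that of Euclidean balls of the same radius. -/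
def VolScalNonneg (n : ℕ) (μ : Measure X) : Prop :=
  ∃ r : ℝ, 0 < r ∧ ∀ ε : ℝ, 0 < ε → ε ≤ r → ∀ x : X,
    μ (Metric.closedBall x ε) ≤ euclideanBallVol n ε

/-- `Sc^{vol_n}(X) ≥ κ` for `κ > 0` and `n ≥ 2`: for every `γ > √(2/κ)`, all sufficiently small
balls (uniformly in the centre) have measure smaller than the balls of the same radius in
`S²(γ) × ℝⁿ⁻²`. -/
def VolScalGEPos (n : ℕ) (κ : ℝ) (μ : Measure X) : Prop :=
  ∀ γ : ℝ, √(2 / κ) < γ → ∃ r : ℝ, 0 < r ∧ ∀ ε : ℝ, 0 < ε → ε ≤ r →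
    ∀ (x : X) (y : S2 × EuclideanSpace ℝ (Fin (n - 2))),
      μ (Metric.closedBall x ε) < volSE γ (n - 2) (ballSE γ y ε)

/-- `Sc^{vol_n}(X) ≥ κ`, a notion defined for `κ ≥ 0`. -/
def VolScalGE (n : ℕ) (κ : ℝ) (μ : Measure X) : Prop :=
  (κ = 0 ∧ VolScalNonneg n μ) ∨ (0 < κ ∧ VolScalGEPos n κ μ)

end Volumic

end VolumicScalar

end

/-!
Fix `x` and `R > 0`, and transport the measure with density proportional to `1 + κ d(·, x)² / 6` on
the ball `B_R(x)` towards the uniform measure on `B_{t²}(x)`, for small `t > 0`. Gluing near-optimal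
plans shows that the point at time `t` of the geodesic issuing from the uniform measure is
concentrated on the ball `B_{t (R + 3t)}(x)`. Hölder's inequality bounds its Rényi functional by a
power of the volume of that ball, while `τⁿ ≥ tⁿ (1 + κ d² / 6 - o(1))`, so that the
curvature-dimension condition reads
`tⁿ (1 - o(1)) ∫_{B_R(x)} (1 + κ d(·, x)² / 6) dμ ≤ μ (B_{t (R + 3t)}(x))`. Dividing by `tⁿ` and
letting `t → 0`, the `n`-dimensional condition turns this into
`∫_{B_R(x)} (1 + κ d(·, x)² / 6) dμ ≤ vol B_R`, and in particular `μ (B_R(x)) ≤ vol B_R`.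

For `κ > 0`, write `d² = R² - (R² - d²)` in the integral. By the layer cake formula and the
comparison of the smaller balls, the integral of `R² - d²` is at most its Euclidean value
`2 R² / (n + 2) * vol B_R`, which gives
`(1 + κ R² / 6) μ (B_R(x)) ≤ (1 + κ R² / (3 (n + 2))) vol B_R`.
Slicing balls of `S²(γ) × ℝⁿ⁻²` into spherical caps bounds their volume below by
`(1 - R² / (3 γ² (n + 2))) vol B_R`; the first-order terms in `R²` compare as required exactly
when `γ² > 2 / (n κ)`.
-/

noncomputable section

namespace VolumicScalar

/-! ### Trigonometric bounds -/

theorem nonneg_of_hasDerivAt_nonneg {f f' : ℝ → ℝ} (hf : ∀ x, HasDerivAt f (f' x) x)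
    (h0 : f 0 = 0) (hf' : ∀ x, 0 ≤ x → 0 ≤ f' x) {x : ℝ} (hx : 0 ≤ x) : 0 ≤ f x := by
  have hmono : MonotoneOn f (Ici 0) :=
    monotoneOn_of_hasDerivWithinAt_nonneg (convex_Ici 0)
      (fun y _ => (hf y).continuousAt.continuousWithinAt) (fun y _ => (hf y).hasDerivWithinAt)
      fun y hy => hf' y (interior_subset hy)
  simpa only [h0] using hmono self_mem_Ici hx hx

theorem cos_le_quartic {x : ℝ} (hx : 0 ≤ x) : Real.cos x ≤ 1 - x ^ 2 / 2 + x ^ 4 / 24 := by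
  refine sub_nonneg.1 (nonneg_of_hasDerivAt_nonneg
    (f := fun x => 1 - x ^ 2 / 2 + x ^ 4 / 24 - Real.cos x)
    (f' := fun x => Real.sin x - (x - x ^ 3 / 6)) (fun x => ?_) (by simp)
    (fun x hx => sub_nonneg.2 (Real.sin_ge_sub_cube hx)) hx)
  have h := ((((hasDerivAt_pow 2 x).div_const 2).const_sub 1).add
    ((hasDerivAt_pow 4 x).div_const 24)).sub (Real.hasDerivAt_cos x)
  exact h.congr_deriv (by push_cast; ring)

theorem sin_le_quintic {x : ℝ} (hx : 0 ≤ x) : Real.sin x ≤ x - x ^ 3 / 6 + x ^ 5 / 120 := by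
  refine sub_nonneg.1 (nonneg_of_hasDerivAt_nonneg
    (f := fun x => x - x ^ 3 / 6 + x ^ 5 / 120 - Real.sin x)
    (f' := fun x => 1 - x ^ 2 / 2 + x ^ 4 / 24 - Real.cos x) (fun x => ?_) (by simp)
    (fun x hx => sub_nonneg.2 (cos_le_quartic hx)) hx)
  have h := (((hasDerivAt_id x).sub ((hasDerivAt_pow 3 x).div_const 6)).add
    ((hasDerivAt_pow 5 x).div_const 120)).sub (Real.hasDerivAt_sin x)
  exact h.congr_deriv (by push_cast; ring)

theorem sq_le_twelve_of_le_pi {x : ℝ} (hx : 0 ≤ x) (hx' : x ≤ Real.pi) : x ^ 2 ≤ 12 := by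
  nlinarith [Real.pi_lt_d2]

theorem sin_mul_one_add_le {x : ℝ} (hx : 0 ≤ x) (hx' : x ≤ Real.pi) :
    Real.sin x * (1 + x ^ 2 / 6) ≤ x := by
  have h12 := sq_le_twelve_of_le_pi hx hx'
  calc Real.sin x * (1 + x ^ 2 / 6) ≤ (x - x ^ 3 / 6 + x ^ 5 / 120) * (1 + x ^ 2 / 6) := by
        gcongr
        exact sin_le_quintic hx
    _ = x - x ^ 5 * (14 - x ^ 2) / 720 := by ring
    _ ≤ x := sub_le_self _ (div_nonneg (mul_nonneg (by positivity) (by linarith)) (by norm_num))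

theorem mul_one_sub_le_sin_mul {t x : ℝ} (ht : 0 ≤ t) (hx : 0 ≤ x) (hx' : x ≤ Real.pi) :
    t * (1 - 2 * t ^ 2) * x ≤ Real.sin (t * x) := by
  have h12 := sq_le_twelve_of_le_pi hx hx'
  calc t * (1 - 2 * t ^ 2) * x = t * x - (t * x) ^ 3 / 6 - t ^ 3 * x * (12 - x ^ 2) / 6 := by ring
    _ ≤ t * x - (t * x) ^ 3 / 6 :=
        sub_le_self _ (div_nonneg (mul_nonneg (by positivity) (by linarith)) (by norm_num))
    _ ≤ Real.sin (t * x) := Real.sin_ge_sub_cube (by positivity)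

theorem le_sin_mul_div_sin {t x : ℝ} (ht : 0 ≤ t) (ht' : 2 * t ^ 2 ≤ 1) (hx : 0 < x)
    (hx' : x < Real.pi) :
    t * (1 - 2 * t ^ 2) * (1 + x ^ 2 / 6) ≤ Real.sin (t * x) / Real.sin x := by
  rw [le_div_iff₀ (Real.sin_pos_of_pos_of_lt_pi hx hx')]
  calc t * (1 - 2 * t ^ 2) * (1 + x ^ 2 / 6) * Real.sin x
      = t * (1 - 2 * t ^ 2) * (Real.sin x * (1 + x ^ 2 / 6)) := by ring
    _ ≤ t * (1 - 2 * t ^ 2) * x :=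
        mul_le_mul_of_nonneg_left (sin_mul_one_add_le hx.le hx'.le)
          (mul_nonneg ht (sub_nonneg.2 ht'))
    _ ≤ Real.sin (t * x) := mul_one_sub_le_sin_mul ht hx.le hx'.le

/-! ### The distortion coefficient -/

theorem rpow_one_div_mul_rpow_rpow {a b N : ℝ} (ha : 0 ≤ a) (hb : 0 ≤ b) (hN : N ≠ 0) :
    (a ^ (1 / N) * b ^ (1 - 1 / N)) ^ N = a * b ^ (N - 1) := by
  rw [Real.mul_rpow (by positivity) (by positivity), ← Real.rpow_mul ha, ← Real.rpow_mul hb,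
    one_div_mul_cancel hN, Real.rpow_one, sub_mul, one_mul, one_div_mul_cancel hN]

theorem le_mul_sin_div_sin_rpow {N t x : ℝ} (hN : 2 ≤ N) (ht : 0 < t) (ht' : 2 * t ^ 2 ≤ 1)
    (hx : 0 < x) (hx' : x < Real.pi) :
    t ^ N * (1 - 2 * t ^ 2) ^ (N - 1) * (1 + (N - 1) * x ^ 2 / 6)
      ≤ t * (Real.sin (t * x) / Real.sin x) ^ (N - 1) := by
  have hs : 0 ≤ 1 - 2 * t ^ 2 := sub_nonneg.2 ht'
  have hbernoulli : 1 + (N - 1) * (x ^ 2 / 6) ≤ (1 + x ^ 2 / 6) ^ (N - 1) :=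
    one_add_mul_self_le_rpow_one_add (by linarith [sq_nonneg x]) (by linarith)
  calc t ^ N * (1 - 2 * t ^ 2) ^ (N - 1) * (1 + (N - 1) * x ^ 2 / 6)
      ≤ t ^ N * (1 - 2 * t ^ 2) ^ (N - 1) * (1 + x ^ 2 / 6) ^ (N - 1) := by
        rw [mul_div_assoc]
        gcongr
    _ = t * (t * (1 - 2 * t ^ 2) * (1 + x ^ 2 / 6)) ^ (N - 1) := by
        rw [Real.mul_rpow (by positivity) (by positivity), Real.mul_rpow ht.le hs,
          Real.rpow_sub_one ht.ne']
        field_simp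
    _ ≤ t * (Real.sin (t * x) / Real.sin x) ^ (N - 1) := by
        gcongr
        · linarith
        · exact le_sin_mul_div_sin ht.le ht' hx hx'

theorem ofReal_le_tau_rpow {κ N t θ : ℝ} (hN : 2 ≤ N) (hκ : 0 ≤ κ) (ht : 0 < t)
    (ht' : 2 * t ^ 2 ≤ 1) (hθ : 0 ≤ θ) :
    ENNReal.ofReal (t ^ N * (1 - 2 * t ^ 2) ^ (N - 1) * (1 + κ * θ ^ 2 / 6))
      ≤ tau κ N t θ ^ N := by
  have hN0 : 0 < N := by linarith
  have hN1 : 0 < N - 1 := by linarith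
  have hs : 0 ≤ 1 - 2 * t ^ 2 := sub_nonneg.2 ht'
  rcases eq_or_ne (κ * θ ^ 2) 0 with h0 | h0
  · rw [tau, if_pos h0, ENNReal.ofReal_rpow_of_pos ht, h0, zero_div, add_zero, mul_one]
    exact ENNReal.ofReal_le_ofReal (mul_le_of_le_one_right (by positivity)
      (Real.rpow_le_one hs (by linarith [sq_nonneg t]) hN1.le))
  have hpos : 0 < κ * θ ^ 2 := lt_of_le_of_ne (by positivity) h0.symm
  have hκ' : 0 < κ := pos_of_mul_pos_left hpos (sq_nonneg θ)
  have hθ' : 0 < θ := hθ.lt_of_ne' (by rintro rfl; simp at h0)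
  rw [tau, if_neg h0, if_pos hpos]
  split_ifs with hπ
  · simp only [ENNReal.top_rpow_of_pos hN0, le_top]
  set φ := θ * √(κ / (N - 1)) with hφ
  have hφ2 : (N - 1) * φ ^ 2 = κ * θ ^ 2 := by
    rw [hφ, mul_pow, Real.sq_sqrt (by positivity)]
    field_simp
  have hφ0 : 0 < φ := by positivity
  have hφπ : φ < Real.pi := by
    rw [not_le, ← hφ2] at hπ
    exact lt_of_pow_lt_pow_left₀ 2 Real.pi_pos.le (lt_of_mul_lt_mul_left hπ hN1.le)
  have hquot : 0 ≤ Real.sin (t * φ) / Real.sin φ :=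
    (mul_nonneg (mul_nonneg ht.le hs) (by positivity)).trans
      (le_sin_mul_div_sin ht.le ht' hφ0 hφπ)
  rw [mul_assoc t, ENNReal.ofReal_rpow_of_nonneg (by positivity) hN0.le,
    rpow_one_div_mul_rpow_rpow ht.le hquot hN0.ne', ← hφ2]
  exact ENNReal.ofReal_le_ofReal (le_mul_sin_div_sin_rpow hN ht ht' hφ0 hφπ)

theorem ofReal_mul_ofReal_le_tau_rpow {κ N t θ a ε R : ℝ} (hN : 2 ≤ N) (hκ : 0 ≤ κ) (ht : 0 < t)
    (ht' : 2 * t ^ 2 ≤ 1) (hθ : 0 ≤ θ) (ha : 0 ≤ a) (hε : 0 ≤ ε) (haθ : a ≤ θ + ε) (haR : a ≤ R) :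
    ENNReal.ofReal (t ^ N * (1 - 2 * t ^ 2) ^ (N - 1) * (1 - κ * ε * R / 3))
      * ENNReal.ofReal (1 + κ * a ^ 2 / 6) ≤ tau κ N t θ ^ N := by
  refine le_trans ?_ (ofReal_le_tau_rpow hN hκ ht ht' hθ)
  rw [← ENNReal.ofReal_mul' (by positivity), mul_assoc (t ^ N * _)]
  have : 0 ≤ 1 - 2 * t ^ 2 := sub_nonneg.2 ht'
  have hR : 0 ≤ R := ha.trans haR
  have hsq : a ^ 2 - 2 * ε * R ≤ θ ^ 2 := by
    rcases le_total a ε with h | h <;> nlinarith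
  gcongr
  calc (1 - κ * ε * R / 3) * (1 + κ * a ^ 2 / 6)
      = 1 + κ * (a ^ 2 - 2 * ε * R) / 6 - κ * ε * R / 3 * (κ * a ^ 2 / 6) := by ring
    _ ≤ 1 + κ * (a ^ 2 - 2 * ε * R) / 6 := sub_le_self _ (by positivity)
    _ ≤ 1 + κ * θ ^ 2 / 6 := by gcongr

/-! ### Euclidean balls -/

theorem euclideanBallVol_pos (n : ℕ) {r : ℝ} (hr : 0 < r) : 0 < euclideanBallVol n r :=
  Metric.measure_closedBall_pos _ _ hr

theorem euclideanBallVol_lt_top (n : ℕ) (r : ℝ) : euclideanBallVol n r < ∞ :=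
  measure_closedBall_lt_top

theorem euclideanBallVol_mul (n : ℕ) {t r : ℝ} (ht : 0 ≤ t) (hr : 0 ≤ r) :
    euclideanBallVol n (t * r) = ENNReal.ofReal (t ^ n) * euclideanBallVol n r := by
  rw [euclideanBallVol, Measure.addHaar_closedBall_mul _ _ ht hr, finrank_euclideanSpace_fin,
    euclideanBallVol]

theorem tendsto_euclideanBallVol (n : ℕ) {R : ℝ} (hR : 0 < R) :
    Tendsto (euclideanBallVol n) (𝓝 R) (𝓝 (euclideanBallVol n R)) := by
  have heq : (fun r => ENNReal.ofReal (r ^ n) * euclideanBallVol n 1)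
      =ᶠ[𝓝 R] euclideanBallVol n := by
    filter_upwards [lt_mem_nhds hR] with r hr
    rw [← euclideanBallVol_mul n hr.le zero_le_one, mul_one]
  refine Tendsto.congr' heq ?_
  rw [← heq.eq_of_nhds]
  exact ENNReal.Tendsto.mul_const (ENNReal.tendsto_ofReal (tendsto_id.pow n))
    (Or.inr (euclideanBallVol_lt_top n 1).ne)

theorem euclideanBallVol_eq {n : ℕ} (hn : 0 < n) {r : ℝ} (hr : 0 ≤ r) :
    euclideanBallVol n r
      = ENNReal.ofReal (r ^ n * (√Real.pi ^ n / Real.Gamma (n / 2 + 1))) := by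
  have : Nonempty (Fin n) := Fin.pos_iff_nonempty.mp hn
  rw [euclideanBallVol, EuclideanSpace.volume_closedBall, Fintype.card_fin,
    ENNReal.ofReal_mul (by positivity), ENNReal.ofReal_pow hr]

theorem euclideanBallVol_add_two {n : ℕ} (hn : 0 < n) {r : ℝ} (hr : 0 ≤ r) :
    euclideanBallVol (n + 2) r
      = ENNReal.ofReal (2 * Real.pi * r ^ 2 / (n + 2)) * euclideanBallVol n r := by
  have hΓ : Real.Gamma (((n + 2 : ℕ) : ℝ) / 2 + 1)
      = ((n : ℝ) / 2 + 1) * Real.Gamma ((n : ℝ) / 2 + 1) := by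
    rw [← Real.Gamma_add_one (by positivity)]
    congr 1
    push_cast
    ring
  have : Real.Gamma ((n : ℝ) / 2 + 1) ≠ 0 := (Real.Gamma_pos_of_pos (by positivity)).ne'
  rw [euclideanBallVol_eq (by lia) hr, euclideanBallVol_eq hn hr,
    ← ENNReal.ofReal_mul (by positivity), hΓ, pow_add (√Real.pi), Real.sq_sqrt Real.pi_pos.le,
    pow_add r]
  congr 1
  field_simp

theorem euclideanBallVol_two {r : ℝ} (hr : 0 ≤ r) :
    euclideanBallVol 2 r = ENNReal.ofReal (Real.pi * r ^ 2) := by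
  rw [euclideanBallVol, EuclideanSpace.volume_closedBall_fin_two,
    ENNReal.ofReal_mul Real.pi_pos.le, ENNReal.ofReal_pow hr, mul_comm]

theorem euclideanBallVol_four {r : ℝ} (hr : 0 ≤ r) :
    euclideanBallVol 4 r = ENNReal.ofReal (Real.pi ^ 2 / 2 * r ^ 4) := by
  rw [euclideanBallVol_add_two (n := 2) two_pos hr, euclideanBallVol_two hr,
    ← ENNReal.ofReal_mul (by positivity)]
  congr 1
  push_cast
  ring

section Slicing

variable {m : ℕ} {R : ℝ}

theorem volume_closedBall_eq_euclideanBallVol {E : Type*} [NormedAddCommGroup E]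
    [InnerProductSpace ℝ E] [FiniteDimensional ℝ E] [MeasurableSpace E] [BorelSpace E] {n : ℕ}
    (hE : Module.finrank ℝ E = n) (x : E) (r : ℝ) :
    volume (Metric.closedBall x r) = euclideanBallVol n r := by
  let b := (stdOrthonormalBasis ℝ E).reindex (finCongr hE)
  rw [Measure.addHaar_closedBall_center, ← b.measurePreserving_repr_symm.measure_preimage
    measurableSet_closedBall.nullMeasurableSet, LinearIsometryEquiv.preimage_closedBall]
  simp only [euclideanBallVol, map_zero]

theorem volume_sq_dist_add_sq_norm_le (y : EuclideanSpace ℝ (Fin m)) (k : ℕ) (hR : 0 ≤ R) :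
    (volume : Measure (EuclideanSpace ℝ (Fin m) × EuclideanSpace ℝ (Fin k)))
      {p | dist p.1 y ^ 2 + ‖p.2‖ ^ 2 ≤ R ^ 2} = euclideanBallVol (m + k) R := by
  let E := WithLp 2 (EuclideanSpace ℝ (Fin m) × EuclideanSpace ℝ (Fin k))
  have hE : Module.finrank ℝ E = m + k := by
    rw [(WithLp.linearEquiv 2 ℝ _).finrank_eq, Module.finrank_prod, finrank_euclideanSpace_fin,
      finrank_euclideanSpace_fin]
  rw [← volume_closedBall_eq_euclideanBallVol hE (WithLp.toLp 2 (y, 0)),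
    ← (WithLp.volume_preserving_toLp _ _).measure_preimage
      measurableSet_closedBall.nullMeasurableSet]
  congr 1 with p
  rw [mem_preimage, Metric.mem_closedBall, WithLp.prod_dist_eq_of_L2, Real.sqrt_le_left hR]
  change dist p.1 y ^ 2 + ‖p.2‖ ^ 2 ≤ R ^ 2 ↔ dist p.1 y ^ 2 + dist p.2 0 ^ 2 ≤ R ^ 2
  rw [dist_zero_right]

theorem lintegral_euclideanBallVol_slice (y : EuclideanSpace ℝ (Fin m)) (k : ℕ) (hR : 0 ≤ R) :
    ∫⁻ z in Metric.closedBall y R, euclideanBallVol k (√(R ^ 2 - dist z y ^ 2))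
      = euclideanBallVol (m + k) R := by
  rw [← volume_sq_dist_add_sq_norm_le y k hR, Measure.volume_eq_prod,
    Measure.prod_apply (measurableSet_le (by fun_prop) (by fun_prop)),
    ← lintegral_indicator measurableSet_closedBall]
  congr 1 with z
  by_cases hz : dist z y ≤ R
  · have hz2 : dist z y ^ 2 ≤ R ^ 2 := by gcongr
    rw [indicator_of_mem (Metric.mem_closedBall.2 hz), euclideanBallVol]
    congr 1 with w
    rw [mem_closedBall_zero_iff, Real.le_sqrt (norm_nonneg _) (by linarith), le_sub_iff_add_le']
    rfl
  · have hempty : Prod.mk z ⁻¹' {p : _ × EuclideanSpace ℝ (Fin k) |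
        dist p.1 y ^ 2 + ‖p.2‖ ^ 2 ≤ R ^ 2} = ∅ :=
      eq_empty_of_forall_notMem fun w hw => hz (abs_le_of_sq_le_sq'
        ((le_add_of_nonneg_right (sq_nonneg ‖w‖)).trans hw) hR).2
    rw [indicator_of_notMem (Metric.mem_closedBall.not.2 hz), hempty, measure_empty]

theorem lintegral_pi_mul_sq_sub_dist_sq (y : EuclideanSpace ℝ (Fin m)) (hR : 0 ≤ R) :
    ∫⁻ z in Metric.closedBall y R, ENNReal.ofReal (Real.pi * (R ^ 2 - dist z y ^ 2))
      = euclideanBallVol (m + 2) R := by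
  rw [← lintegral_euclideanBallVol_slice y 2 hR]
  refine setLIntegral_congr_fun measurableSet_closedBall fun z hz => ?_
  have hz2 : dist z y ^ 2 ≤ R ^ 2 := pow_le_pow_left₀ dist_nonneg hz 2
  rw [euclideanBallVol_two (Real.sqrt_nonneg _), Real.sq_sqrt (sub_nonneg.2 hz2)]

theorem lintegral_pi_sq_mul_sq_sub_dist_sq_sq (y : EuclideanSpace ℝ (Fin m)) (hR : 0 ≤ R) :
    ∫⁻ z in Metric.closedBall y R,
      ENNReal.ofReal (Real.pi ^ 2 / 2 * (R ^ 2 - dist z y ^ 2) ^ 2)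
      = euclideanBallVol (m + 4) R := by
  rw [← lintegral_euclideanBallVol_slice y 4 hR]
  refine setLIntegral_congr_fun measurableSet_closedBall fun z hz => ?_
  have hz2 : dist z y ^ 2 ≤ R ^ 2 := pow_le_pow_left₀ dist_nonneg hz 2
  rw [euclideanBallVol_four (Real.sqrt_nonneg _), pow_mul (√_) 2 2,
    Real.sq_sqrt (sub_nonneg.2 hz2)]

end Slicing

/-! ### Balls in `S²(γ) × ℝᵐ` -/

section Revolution

/-- The solid in `ℝ × V` swept out over the heights in `Ioc a b` by the ball of `V` of radius
`√(f h)`. The first factor is the axis. -/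
def solidOfRevolution (V : Type*) [NormedAddCommGroup V] (a b : ℝ) (f : ℝ → ℝ) : Set (ℝ × V) :=
  {p | p.1 ∈ Ioc a b ∧ ‖p.2‖ ^ 2 < f p.1}

theorem measurableSet_solidOfRevolution {V : Type*} [NormedAddCommGroup V] [MeasurableSpace V]
    [OpensMeasurableSpace V] (a b : ℝ) {f : ℝ → ℝ} (hf : Measurable f) :
    MeasurableSet (solidOfRevolution V a b f) :=
  (measurable_fst measurableSet_Ioc).inter
    (measurableSet_lt (measurable_snd.norm.pow_const 2) (hf.comp measurable_fst))

theorem cone_union_cap_subset_sector {V : Type*} [NormedAddCommGroup V] {c : ℝ} (hc : 0 < c) :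
    solidOfRevolution V 0 c (fun h => h ^ 2 * (1 - c ^ 2) / c ^ 2)
        ∪ solidOfRevolution V c 1 (fun h => 1 - h ^ 2)
      ⊆ {p | 0 < p.1 ∧ p.1 ^ 2 + ‖p.2‖ ^ 2 < 1 ∧ c ^ 2 * (p.1 ^ 2 + ‖p.2‖ ^ 2) ≤ p.1 ^ 2} := by
  rintro ⟨h, w⟩ (⟨⟨h0, hhc⟩, hw⟩ | ⟨⟨hch, -⟩, hw⟩)
  · have hh2 : h ^ 2 ≤ c ^ 2 := pow_le_pow_left₀ h0.le hhc 2
    have hcone : c ^ 2 * (h ^ 2 + ‖w‖ ^ 2) < h ^ 2 := by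
      have hw' : ‖w‖ ^ 2 * c ^ 2 < h ^ 2 * (1 - c ^ 2) := (lt_div_iff₀ (by positivity)).1 hw
      linarith
    exact ⟨h0, lt_of_mul_lt_mul_left ((hcone.trans_le hh2).trans_eq (mul_one _).symm)
      (sq_nonneg c), hcone.le⟩
  · have hball : h ^ 2 + ‖w‖ ^ 2 < 1 := lt_sub_iff_add_lt'.1 hw
    exact ⟨hc.trans hch, hball, (mul_le_of_le_one_right (sq_nonneg c) hball.le).trans
      (pow_le_pow_left₀ hc.le hch.le 2)⟩

variable {V : Type*} [NormedAddCommGroup V] [InnerProductSpace ℝ V] [FiniteDimensional ℝ V]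
  [MeasurableSpace V] [BorelSpace V]

theorem volume_ball_sqrt_of_finrank_eq_two (hV : Module.finrank ℝ V = 2) {s : ℝ} (hs : 0 ≤ s) :
    volume (Metric.ball (0 : V) √s) = ENNReal.ofReal (Real.pi * s) := by
  have : Nontrivial V := Module.nontrivial_of_finrank_pos (R := ℝ) (by lia)
  rw [← Measure.addHaar_closedBall_eq_addHaar_ball, volume_closedBall_eq_euclideanBallVol hV,
    euclideanBallVol_two (Real.sqrt_nonneg s), Real.sq_sqrt hs]

theorem volume_solidOfRevolution (hV : Module.finrank ℝ V = 2) {a b : ℝ} (hab : a ≤ b)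
    {f : ℝ → ℝ} (hf : Continuous f) (hf0 : ∀ h ∈ Ioc a b, 0 ≤ f h) :
    volume (solidOfRevolution V a b f) = ENNReal.ofReal (∫ h in a..b, Real.pi * f h) := by
  have hslice : ∀ h, volume (Prod.mk h ⁻¹' solidOfRevolution V a b f)
      = (Ioc a b).indicator (fun h => ENNReal.ofReal (Real.pi * f h)) h := by
    intro h
    by_cases hh : h ∈ Ioc a b
    · rw [indicator_of_mem hh, ← volume_ball_sqrt_of_finrank_eq_two hV (hf0 h hh)]
      congr 1 with w
      rw [mem_ball_zero_iff, Real.lt_sqrt (norm_nonneg w)]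
      exact and_iff_right hh
    · rw [indicator_of_notMem hh]
      exact measure_mono_null (fun w hw => hh hw.1) measure_empty
  rw [Measure.volume_eq_prod,
    Measure.prod_apply (measurableSet_solidOfRevolution a b hf.measurable),
    lintegral_congr hslice, lintegral_indicator measurableSet_Ioc,
    intervalIntegral.integral_of_le hab, ofReal_integral_eq_lintegral_ofReal]
  · exact (Continuous.integrableOn_Icc (by fun_prop)).mono_set Ioc_subset_Icc_self
  · filter_upwards [ae_restrict_mem measurableSet_Ioc] with h hh
    exact mul_nonneg Real.pi_pos.le (hf0 h hh)

theorem ofReal_le_volume_sector (hV : Module.finrank ℝ V = 2) {c : ℝ} (hc : 0 < c) (hc' : c ≤ 1) :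
    ENNReal.ofReal (2 * Real.pi / 3 * (1 - c)) ≤
      (volume : Measure (ℝ × V)) {p | 0 < p.1 ∧ p.1 ^ 2 + ‖p.2‖ ^ 2 < 1 ∧
        c ^ 2 * (p.1 ^ 2 + ‖p.2‖ ^ 2) ≤ p.1 ^ 2} := by
  have hc2 : 0 ≤ 1 - c ^ 2 := sub_nonneg.2 (pow_le_one₀ hc.le hc')
  let cone := solidOfRevolution V 0 c fun h => h ^ 2 * (1 - c ^ 2) / c ^ 2
  let cap := solidOfRevolution V c 1 fun h => 1 - h ^ 2
  have hcone : volume cone = ENNReal.ofReal (Real.pi * (c * (1 - c ^ 2) / 3)) := by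
    rw [volume_solidOfRevolution hV hc.le (by fun_prop) fun h _ => by positivity,
      intervalIntegral.integral_const_mul, intervalIntegral.integral_div,
      intervalIntegral.integral_mul_const, integral_pow]
    congr 2
    field_simp
    ring
  have hcap : volume cap = ENNReal.ofReal (Real.pi * (2 / 3 - c + c ^ 3 / 3)) := by
    rw [volume_solidOfRevolution hV hc' (by fun_prop) fun h hh =>
        sub_nonneg.2 (pow_le_one₀ (hc.trans hh.1).le hh.2),
      intervalIntegral.integral_const_mul, intervalIntegral.integral_sub (by simp) (by simp),
      integral_pow, integral_one]
    congr 2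
    norm_num
    ring
  have hdisj : Disjoint cone cap :=
    disjoint_left.2 fun p hp hp' => (hp.1.2.trans_lt hp'.1.1).false
  calc ENNReal.ofReal (2 * Real.pi / 3 * (1 - c))
      = ENNReal.ofReal (Real.pi * (c * (1 - c ^ 2) / 3)
          + Real.pi * (2 / 3 - c + c ^ 3 / 3)) := by congr 1; ring
    _ ≤ volume cone + volume cap := by
        rw [hcone, hcap]
        exact ENNReal.ofReal_add_le
    _ = volume (cone ∪ cap) :=
        (measure_union hdisj (measurableSet_solidOfRevolution c 1 (by fun_prop))).symm
    _ ≤ _ := measure_mono (cone_union_cap_subset_sector hc)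

end Revolution

section SphericalCap

variable {E : Type*} [NormedAddCommGroup E] [InnerProductSpace ℝ E]

theorem norm_smul_add_sq {v : E} (hv : ‖v‖ = 1) (h : ℝ) (w : (ℝ ∙ v)ᗮ) :
    ‖h • v + (w : E)‖ ^ 2 = h ^ 2 + ‖w‖ ^ 2 := by
  have hvw : inner ℝ v (w : E) = 0 := Submodule.mem_orthogonal_singleton_iff_inner_right.1 w.2
  rw [norm_add_sq_real, real_inner_smul_left, hvw, norm_smul, hv, mul_one, Real.norm_eq_abs,
    sq_abs, mul_zero, mul_zero, add_zero, Submodule.coe_norm]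

theorem inner_smul_add_self {v : E} (hv : ‖v‖ = 1) (h : ℝ) (w : (ℝ ∙ v)ᗮ) :
    inner ℝ (h • v + (w : E)) v = h := by
  rw [inner_add_left, real_inner_smul_left, real_inner_self_eq_norm_sq, hv,
    Submodule.mem_orthogonal_singleton_iff_inner_left.1 w.2, one_pow, mul_one, add_zero]

theorem measurable_angle_left [MeasurableSpace E] [BorelSpace E] (v : E) :
    Measurable fun x => InnerProductGeometry.angle x v := by
  unfold InnerProductGeometry.angle
  exact Real.continuous_arccos.measurable.comp
    ((continuous_id.inner continuous_const).measurable.div (measurable_norm.mul_const _))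

theorem measurePreserving_smul_add [FiniteDimensional ℝ E] [MeasurableSpace E] [BorelSpace E]
    {v : E} (hv : ‖v‖ = 1) :
    MeasurePreserving (fun p : ℝ × (ℝ ∙ v)ᗮ => p.1 • v + (p.2 : E)) volume volume := by
  let K := ℝ ∙ v
  let e : ℝ ≃ₗᵢ[ℝ] K := LinearIsometryEquiv.toSpanUnitSingleton v hv
  have he : MeasurePreserving (Prod.map e (id : Kᗮ → Kᗮ)) volume volume :=
    e.measurePreserving.prod (MeasurePreserving.id _)
  exact K.orthogonalDecomposition.symm.measurePreserving.comp
    ((WithLp.volume_preserving_toLp K Kᗮ).comp he)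

theorem ofReal_le_volume_angle_le [FiniteDimensional ℝ E] [MeasurableSpace E] [BorelSpace E]
    (hE : Module.finrank ℝ E = 3) {v : E} (hv : ‖v‖ = 1) {α : ℝ} (hα : 0 ≤ α)
    (hα' : α < Real.pi / 2) :
    ENNReal.ofReal (2 * Real.pi / 3 * (1 - Real.cos α)) ≤
      volume {x : E | ‖x‖ < 1 ∧ InnerProductGeometry.angle x v ≤ α} := by
  have hcos : 0 < Real.cos α := Real.cos_pos_of_mem_Ioo ⟨by linarith, hα'⟩
  have hmeas : MeasurableSet {x : E | ‖x‖ < 1 ∧ InnerProductGeometry.angle x v ≤ α} :=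
    (measurableSet_lt measurable_norm measurable_const).inter
      (measurableSet_le (measurable_angle_left v) measurable_const)
  have hfinrank : Module.finrank ℝ (ℝ ∙ v)ᗮ = 2 :=
    haveI : Fact (Module.finrank ℝ E = 2 + 1) := ⟨hE⟩
    Submodule.finrank_orthogonal_span_singleton (norm_ne_zero_iff.1 (by rw [hv]; exact one_ne_zero))
  rw [← (measurePreserving_smul_add hv).measure_preimage hmeas.nullMeasurableSet]
  refine (ofReal_le_volume_sector hfinrank hcos (Real.cos_le_one α)).trans (measure_mono ?_)
  rintro ⟨h, w⟩ ⟨h0, hball, hcone⟩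
  rw [← norm_smul_add_sq hv] at hball hcone
  have hpos : 0 < ‖h • v + (w : E)‖ := by
    refine (norm_nonneg _).lt_of_ne' fun h' => h0.ne' ?_
    rw [← inner_smul_add_self hv h w, norm_eq_zero.1 h', inner_zero_left]
  refine ⟨(sq_lt_one_iff₀ (norm_nonneg _)).1 hball, ?_⟩
  rw [InnerProductGeometry.angle, inner_smul_add_self hv, hv, mul_one,
    ← Real.arccos_cos hα (by linarith [Real.pi_pos])]
  refine Real.arccos_le_arccos ((le_div_iff₀ hpos).2 (le_of_sq_le_sq ?_ h0.le))
  rwa [mul_pow]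

theorem ofReal_le_toSphere_angle_le (y : S2) {α : ℝ} (hα : 0 ≤ α) (hα' : α < Real.pi / 2) :
    ENNReal.ofReal (2 * Real.pi * (1 - Real.cos α)) ≤
      (volume : Measure (EuclideanSpace ℝ (Fin 3))).toSphere
        {u | InnerProductGeometry.angle (u : EuclideanSpace ℝ (Fin 3)) y ≤ α} := by
  have hmeas : MeasurableSet
      {u : S2 | InnerProductGeometry.angle (u : EuclideanSpace ℝ (Fin 3)) y ≤ α} :=
    measurableSet_le ((measurable_angle_left _).comp measurable_subtype_coe) measurable_const
  rw [Measure.toSphere_apply' _ hmeas, finrank_euclideanSpace_fin]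
  calc ENNReal.ofReal (2 * Real.pi * (1 - Real.cos α))
      = ((3 : ℕ) : ℝ≥0∞) * ENNReal.ofReal (2 * Real.pi / 3 * (1 - Real.cos α)) := by
        rw [← ENNReal.ofReal_natCast, ← ENNReal.ofReal_mul (by positivity)]
        congr 1
        push_cast
        ring
    _ ≤ 3 * volume {x : EuclideanSpace ℝ (Fin 3) |
          ‖x‖ < 1 ∧ InnerProductGeometry.angle x y ≤ α} := by
        rw [Nat.cast_ofNat]
        gcongr
        exact ofReal_le_volume_angle_le finrank_euclideanSpace_fin (norm_eq_of_mem_sphere y) hα hα'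
    _ ≤ _ := by
        refine mul_le_mul_right (measure_mono ?_) _
        rintro x ⟨hx1, hxα⟩
        -- Mathlib's angle between `0` and any vector is `π / 2`.
        have hx : x ≠ 0 := by
          rintro rfl
          exact (hxα.trans_lt hα').ne (InnerProductGeometry.angle_zero_left _)
        have hpos : 0 < ‖x‖ := norm_pos_iff.2 hx
        refine mem_smul.2 ⟨‖x‖, ⟨hpos, hx1⟩, ‖x‖⁻¹ • x, ⟨⟨‖x‖⁻¹ • x, ?_⟩, ?_, rfl⟩, ?_⟩
        · exact mem_sphere_zero_iff_norm.2 (norm_smul_inv_norm hx)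
        · exact (InnerProductGeometry.angle_smul_left_of_pos _ _ (inv_pos.2 hpos)).trans_le hxα
        · exact smul_inv_smul₀ hpos.ne' x

theorem ofReal_le_volS_closedBall {γ ρ : ℝ} (hγ : 0 < γ) (hρ : 0 ≤ ρ)
    (hργ : ρ < γ * (Real.pi / 2)) (y : S2) :
    ENNReal.ofReal (Real.pi * ρ ^ 2 - Real.pi * (ρ ^ 2) ^ 2 / (12 * γ ^ 2))
      ≤ volS γ {u | distS γ u y ≤ ρ} := by
  have hset : {u : S2 | distS γ u y ≤ ρ}
      = {u : S2 | InnerProductGeometry.angle (u : EuclideanSpace ℝ (Fin 3)) y ≤ ρ / γ} := by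
    ext u
    exact (le_div_iff₀' hγ).symm
  have hcos := cos_le_quartic (x := ρ / γ) (by positivity)
  rw [hset, volS, Measure.smul_apply, smul_eq_mul]
  calc ENNReal.ofReal (Real.pi * ρ ^ 2 - Real.pi * (ρ ^ 2) ^ 2 / (12 * γ ^ 2))
      = ENNReal.ofReal (γ ^ 2 * (2 * Real.pi * ((ρ / γ) ^ 2 / 2 - (ρ / γ) ^ 4 / 24))) := by
        congr 1
        field_simp
        ring
    _ ≤ ENNReal.ofReal (γ ^ 2 * (2 * Real.pi * (1 - Real.cos (ρ / γ)))) := by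
        gcongr ENNReal.ofReal (γ ^ 2 * (2 * Real.pi * ?_))
        linarith
    _ ≤ _ := by
        rw [ENNReal.ofReal_mul (by positivity)]
        gcongr
        exact ofReal_le_toSphere_angle_le y (by positivity) ((div_lt_iff₀' hγ).2 hργ)

end SphericalCap

section Product

variable {γ r : ℝ} {m : ℕ}

instance isFiniteMeasure_volS (γ : ℝ) : IsFiniteMeasure (volS γ) :=
  Measure.smul_finite _ ENNReal.ofReal_ne_top

theorem measurableSet_ballSE (γ : ℝ) (y : S2 × EuclideanSpace ℝ (Fin m)) (r : ℝ) :
    MeasurableSet (ballSE γ y r) := by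
  have hdistS : Measurable fun p : S2 × EuclideanSpace ℝ (Fin m) => distS γ p.1 y.1 :=
    (((measurable_angle_left _).comp measurable_subtype_coe).const_mul γ).comp measurable_fst
  have hdist : Measurable fun p : S2 × EuclideanSpace ℝ (Fin m) => dist p.2 y.2 := by fun_prop
  exact measurableSet_le ((hdistS.pow_const 2).add (hdist.pow_const 2)).sqrt measurable_const

theorem ballSE_slice (hγ : 0 ≤ γ) (hr : 0 ≤ r) (y : S2 × EuclideanSpace ℝ (Fin m))
    (z : EuclideanSpace ℝ (Fin m)) (hz : dist z y.2 ≤ r) :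
    (fun u => (u, z)) ⁻¹' ballSE γ y r = {u | distS γ u y.1 ≤ √(r ^ 2 - dist z y.2 ^ 2)} := by
  ext u
  have hdistS : 0 ≤ distS γ u y.1 := mul_nonneg hγ (InnerProductGeometry.angle_nonneg _ _)
  have hz2 : dist z y.2 ^ 2 ≤ r ^ 2 := pow_le_pow_left₀ dist_nonneg hz 2
  change √(distS γ u y.1 ^ 2 + dist z y.2 ^ 2) ≤ r ↔ distS γ u y.1 ≤ √(r ^ 2 - dist z y.2 ^ 2)
  rw [Real.sqrt_le_left hr, Real.le_sqrt hdistS (sub_nonneg.2 hz2), le_sub_iff_add_le]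

theorem ofReal_le_volS_ballSE_slice (hγ : 0 < γ) (hr : 0 ≤ r) (hrγ : r < γ * (Real.pi / 2))
    (y : S2 × EuclideanSpace ℝ (Fin m)) (z : EuclideanSpace ℝ (Fin m)) (hz : dist z y.2 ≤ r) :
    ENNReal.ofReal (Real.pi * (r ^ 2 - dist z y.2 ^ 2)
        - Real.pi * (r ^ 2 - dist z y.2 ^ 2) ^ 2 / (12 * γ ^ 2))
      ≤ volS γ ((fun u => (u, z)) ⁻¹' ballSE γ y r) := by
  have hz2 : dist z y.2 ^ 2 ≤ r ^ 2 := pow_le_pow_left₀ dist_nonneg hz 2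
  have hle : √(r ^ 2 - dist z y.2 ^ 2) ≤ r :=
    (Real.sqrt_le_left hr).2 (sub_le_self _ (sq_nonneg _))
  have hcap := ofReal_le_volS_closedBall hγ (Real.sqrt_nonneg _) (hle.trans_lt hrγ) y.1
  rwa [Real.sq_sqrt (sub_nonneg.2 hz2), ← ballSE_slice hγ.le hr y z hz] at hcap

theorem euclideanBallVol_le_volSE_add (hγ : 0 < γ) (hr : 0 ≤ r) (hrγ : r < γ * (Real.pi / 2))
    (y : S2 × EuclideanSpace ℝ (Fin m)) :
    euclideanBallVol (m + 2) r ≤ volSE γ m (ballSE γ y r)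
      + ENNReal.ofReal (1 / (6 * Real.pi * γ ^ 2)) * euclideanBallVol (m + 4) r := by
  have hc : 0 ≤ 1 / (6 * Real.pi * γ ^ 2) := by positivity
  rw [← lintegral_pi_mul_sq_sub_dist_sq y.2 hr, ← lintegral_pi_sq_mul_sq_sub_dist_sq_sq y.2 hr,
    ← lintegral_const_mul _ (by fun_prop)]
  calc ∫⁻ z in Metric.closedBall y.2 r, ENNReal.ofReal (Real.pi * (r ^ 2 - dist z y.2 ^ 2))
      ≤ ∫⁻ z in Metric.closedBall y.2 r, (volS γ ((fun u => (u, z)) ⁻¹' ballSE γ y r)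
          + ENNReal.ofReal (1 / (6 * Real.pi * γ ^ 2))
            * ENNReal.ofReal (Real.pi ^ 2 / 2 * (r ^ 2 - dist z y.2 ^ 2) ^ 2)) := by
        refine setLIntegral_mono' measurableSet_closedBall fun z hz => ?_
        refine le_trans ?_ (add_le_add_left (ofReal_le_volS_ballSE_slice hγ hr hrγ y z hz) _)
        rw [← ENNReal.ofReal_mul hc]
        refine le_trans (ENNReal.ofReal_le_ofReal (le_of_eq ?_)) ENNReal.ofReal_add_le
        field_simp
        ring
    _ = (∫⁻ z in Metric.closedBall y.2 r, volS γ ((fun u => (u, z)) ⁻¹' ballSE γ y r))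
          + ∫⁻ z in Metric.closedBall y.2 r, ENNReal.ofReal (1 / (6 * Real.pi * γ ^ 2))
            * ENNReal.ofReal (Real.pi ^ 2 / 2 * (r ^ 2 - dist z y.2 ^ 2) ^ 2) :=
        lintegral_add_right _ (by fun_prop)
    _ ≤ _ := by
        gcongr
        rw [volSE, Measure.prod_apply_symm (measurableSet_ballSE γ y r)]
        exact setLIntegral_le_lintegral _ _

theorem ofReal_mul_euclideanBallVol_le_volSE {n : ℕ} (hn : 2 ≤ n) (hγ : 0 < γ) (hr : 0 ≤ r)
    (hrγ : r < γ * (Real.pi / 2)) (y : S2 × EuclideanSpace ℝ (Fin (n - 2))) :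
    ENNReal.ofReal (1 - r ^ 2 / (3 * γ ^ 2 * (n + 2))) * euclideanBallVol n r
      ≤ volSE γ (n - 2) (ballSE γ y r) := by
  have hcoeff : 1 / (6 * Real.pi * γ ^ 2) * (2 * Real.pi * r ^ 2 / (n + 2))
      = r ^ 2 / (3 * γ ^ 2 * (n + 2)) := by
    field_simp
    ring
  have hvol := euclideanBallVol_le_volSE_add hγ hr hrγ y
  rw [show n - 2 + 4 = n + 2 by lia, Nat.sub_add_cancel hn, euclideanBallVol_add_two (by lia) hr,
    ← mul_assoc, ← ENNReal.ofReal_mul (by positivity), hcoeff] at hvol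
  rw [ENNReal.ofReal_sub _ (by positivity), ENNReal.ofReal_one,
    ENNReal.sub_mul fun _ _ => (euclideanBallVol_lt_top n r).ne, one_mul]
  exact tsub_le_iff_right.2 hvol

end Product

/-! ### Optimal transport -/

section Transport

section Gluing

open ProbabilityTheory

variable {α β γ : Type*} [MeasurableSpace α] [MeasurableSpace β] [MeasurableSpace γ]
  [StandardBorelSpace α] [Nonempty α] [StandardBorelSpace γ] [Nonempty γ]

theorem exists_gluing {q₁ : Measure (α × β)} {q₂ : Measure (β × γ)} [IsFiniteMeasure q₁]
    [IsFiniteMeasure q₂] (h : q₁.snd = q₂.fst) :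
    ∃ π : Measure (β × α × γ), π.map (fun z => (z.2.1, z.1)) = q₁ ∧
      π.map (fun z => (z.1, z.2.2)) = q₂ := by
  have h₁ : (q₁.map Prod.swap).fst = q₂.fst := Measure.fst_map_swap.trans h
  set π := q₂.fst ⊗ₘ ((q₁.map Prod.swap).condKernel ×ₖ q₂.condKernel)
  have hπ₁ : π.map (Prod.map id Prod.fst) = q₁.map Prod.swap := by
    rw [← Measure.compProd_map measurable_fst, ← Kernel.fst_eq, Kernel.fst_prod, ← h₁,
      Measure.disintegrate]
  have hπ₂ : π.map (Prod.map id Prod.snd) = q₂ := by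
    rw [← Measure.compProd_map measurable_snd, ← Kernel.snd_eq, Kernel.snd_prod,
      Measure.disintegrate]
  refine ⟨π, ?_, hπ₂⟩
  calc π.map (fun z => (z.2.1, z.1)) = (π.map (Prod.map id Prod.fst)).map Prod.swap :=
        (Measure.map_map measurable_swap (measurable_id.prodMap measurable_fst)).symm
    _ = q₁ := by
        rw [hπ₁, Measure.map_map measurable_swap measurable_swap, Prod.swap_swap_eq,
          Measure.map_id]

end Gluing

section Coupling

variable {X : Type*} [MeasurableSpace X] {q : Measure (X × X)} {ν₀ ν₁ : Measure X}

theorem IsCoupling.isProbabilityMeasure [IsProbabilityMeasure ν₀] (h : IsCoupling q ν₀ ν₁) :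
    IsProbabilityMeasure q := by
  have : IsProbabilityMeasure (q.map Prod.fst) := by rwa [h.1]
  exact Measure.isProbabilityMeasure_of_map (f := Prod.fst)

theorem IsCoupling.ae_fst (h : IsCoupling q ν₀ ν₁) {P : X → Prop} (hP : ∀ᵐ x ∂ν₀, P x) :
    ∀ᵐ p ∂q, P p.1 :=
  ae_of_ae_map measurable_fst.aemeasurable (by rwa [h.1])

theorem IsCoupling.ae_snd (h : IsCoupling q ν₀ ν₁) {P : X → Prop} (hP : ∀ᵐ x ∂ν₁, P x) :
    ∀ᵐ p ∂q, P p.2 :=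
  ae_of_ae_map measurable_snd.aemeasurable (by rwa [h.2])

end Coupling

theorem sq_interpolation_le {t u v w : ℝ} (ht : 0 ≤ t) (h₁ : w ≤ u + v) (h₂ : u ≤ w + v) :
    t * (1 - t) * w ^ 2 + (u - t * w) ^ 2 ≤ (1 - t) * u ^ 2 + t * v ^ 2 := by
  have h : (w - u) ^ 2 ≤ v ^ 2 := sq_le_sq' (by linarith) (by linarith)
  nlinarith [mul_le_mul_of_nonneg_left h ht]

theorem edist_sq_interpolation_le {Y : Type*} [PseudoMetricSpace Y] {t : ℝ}
    (ht : t ∈ Icc (0 : ℝ) 1) (x₀ y x₁ : Y) :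
    ENNReal.ofReal (t * (1 - t)) * edist x₀ x₁ ^ 2
        + ENNReal.ofReal ((dist x₀ y - t * dist x₀ x₁) ^ 2)
      ≤ ENNReal.ofReal (1 - t) * edist x₀ y ^ 2 + ENNReal.ofReal t * edist y x₁ ^ 2 := by
  have ht₀ := ht.1
  have ht₁ := sub_nonneg.2 ht.2
  simp only [edist_dist, ← ENNReal.ofReal_pow dist_nonneg]
  rw [← ENNReal.ofReal_mul (by positivity), ← ENNReal.ofReal_mul ht₁, ← ENNReal.ofReal_mul ht₀,
    ← ENNReal.ofReal_add (by positivity) (by positivity),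
    ← ENNReal.ofReal_add (by positivity) (by positivity)]
  exact ENNReal.ofReal_le_ofReal (sq_interpolation_le ht₀ (dist_triangle x₀ y x₁)
    (dist_comm y x₁ ▸ dist_triangle x₀ x₁ y))

theorem sub_le_dist_sub_mul_dist {Y : Type*} [PseudoMetricSpace Y] {x x₀ y x₁ : Y}
    {ε R r t : ℝ} (ht : 0 ≤ t) (hx₀ : dist x₀ x ≤ ε) (hx₁ : dist x₁ x ≤ R) (hy : r ≤ dist y x) :
    r - ((1 + t) * ε + t * R) ≤ dist x₀ y - t * dist x₀ x₁ := by
  have hyx : dist y x ≤ dist x₀ y + dist x₀ x := dist_triangle_left y x x₀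
  have hx : t * dist x₀ x₁ ≤ t * (ε + R) := mul_le_mul_of_nonneg_left
    ((dist_triangle_right x₀ x₁ x).trans (add_le_add hx₀ hx₁)) ht
  linarith

variable {X : Type*} [MetricSpace X] [MeasurableSpace X] {ν₀ ν ν₁ : Measure X}

theorem W2_sq (ν₀ ν₁ : Measure X) :
    W2 ν₀ ν₁ ^ 2 = ⨅ q : {q : Measure (X × X) // IsCoupling q ν₀ ν₁}, cost q.1 := by
  rw [W2, ← ENNReal.rpow_natCast, ← ENNReal.rpow_mul]
  norm_num

theorem W2_sq_le_cost {q : Measure (X × X)} (hq : IsCoupling q ν₀ ν₁) :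
    W2 ν₀ ν₁ ^ 2 ≤ cost q :=
  (W2_sq ν₀ ν₁).trans_le (iInf_le_of_le ⟨q, hq⟩ le_rfl)

theorem exists_coupling_cost_lt (hW : W2 ν₀ ν₁ ≠ ∞) {η : ℝ≥0∞} (hη : η ≠ 0) :
    ∃ q, IsCoupling q ν₀ ν₁ ∧ cost q < W2 ν₀ ν₁ ^ 2 + η := by
  have h := ENNReal.lt_add_right (ENNReal.pow_ne_top hW (n := 2)) hη
  rw [W2_sq] at h ⊢
  obtain ⟨⟨q, hq⟩, hlt⟩ := iInf_lt_iff.1 h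
  exact ⟨q, hq, hlt⟩

variable [BorelSpace X] [SecondCountableTopology X]

theorem cost_map {Z : Type*} [MeasurableSpace Z] {π : Measure Z} {f g : Z → X}
    (hf : Measurable f) (hg : Measurable g) :
    cost (π.map fun z => (f z, g z)) = ∫⁻ z, edist (f z) (g z) ^ 2 ∂π :=
  lintegral_map (by fun_prop) (by fun_prop)

theorem cost_interpolation_le (π : Measure (X × X × X)) {t : ℝ} (ht : t ∈ Icc (0 : ℝ) 1) :
    ENNReal.ofReal (t * (1 - t)) * cost (π.map fun z => (z.2.1, z.2.2))
        + ∫⁻ z, ENNReal.ofReal ((dist z.2.1 z.1 - t * dist z.2.1 z.2.2) ^ 2) ∂π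
      ≤ ENNReal.ofReal (1 - t) * cost (π.map fun z => (z.2.1, z.1))
        + ENNReal.ofReal t * cost (π.map fun z => (z.1, z.2.2)) := by
  rw [cost_map (by fun_prop) (by fun_prop), cost_map (by fun_prop) (by fun_prop),
    cost_map (by fun_prop) (by fun_prop), ← lintegral_const_mul _ (by fun_prop),
    ← lintegral_const_mul _ (by fun_prop), ← lintegral_const_mul _ (by fun_prop),
    ← lintegral_add_left (by fun_prop), ← lintegral_add_left (by fun_prop)]
  exact lintegral_mono fun z => edist_sq_interpolation_le ht z.2.1 z.1 z.2.2

variable [StandardBorelSpace X] [IsProbabilityMeasure ν₀] [IsProbabilityMeasure ν]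

-- The interpolation inequality for the glued near-optimal plans is an equality up to `η`.
theorem exists_gluing_lintegral_sq_le {t : ℝ} (ht : t ∈ Icc (0 : ℝ) 1) (hW : W2 ν₀ ν₁ ≠ ∞)
    (hW₀ : W2 ν₀ ν = ENNReal.ofReal t * W2 ν₀ ν₁)
    (hW₁ : W2 ν ν₁ = ENNReal.ofReal (1 - t) * W2 ν₀ ν₁) {η : ℝ≥0∞} (hη : η ≠ 0) :
    ∃ π : Measure (X × X × X), IsCoupling (π.map fun z => (z.2.1, z.1)) ν₀ ν ∧
      IsCoupling (π.map fun z => (z.1, z.2.2)) ν ν₁ ∧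
      ∫⁻ z, ENNReal.ofReal ((dist z.2.1 z.1 - t * dist z.2.1 z.2.2) ^ 2) ∂π ≤ η := by
  have := nonempty_of_isProbabilityMeasure ν
  obtain ⟨q₁, hq₁, hc₁⟩ :=
    exists_coupling_cost_lt (hW₀ ▸ ENNReal.mul_ne_top ENNReal.ofReal_ne_top hW) hη
  obtain ⟨q₂, hq₂, hc₂⟩ :=
    exists_coupling_cost_lt (hW₁ ▸ ENNReal.mul_ne_top ENNReal.ofReal_ne_top hW) hη
  have := hq₁.isProbabilityMeasure
  have := hq₂.isProbabilityMeasure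
  obtain ⟨π, rfl, rfl⟩ := exists_gluing (hq₁.2.trans hq₂.1.symm)
  have hq : IsCoupling (π.map fun z => (z.2.1, z.2.2)) ν₀ ν₁ := by
    constructor
    · rw [← hq₁.1, Measure.map_map measurable_fst (by fun_prop),
        Measure.map_map measurable_fst (by fun_prop)]
      rfl
    · rw [← hq₂.2, Measure.map_map measurable_snd (by fun_prop),
        Measure.map_map measurable_snd (by fun_prop)]
      rfl
  refine ⟨π, hq₁, hq₂, ?_⟩
  set D := W2 ν₀ ν₁
  have ht' : ENNReal.ofReal (1 - t) + ENNReal.ofReal t = 1 := by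
    rw [← ENNReal.ofReal_add (sub_nonneg.2 ht.2) ht.1, sub_add_cancel, ENNReal.ofReal_one]
  have hfin : ENNReal.ofReal (t * (1 - t)) * D ^ 2 ≠ ∞ :=
    ENNReal.mul_ne_top ENNReal.ofReal_ne_top (ENNReal.pow_ne_top hW)
  refine (ENNReal.add_le_add_iff_left hfin).1 ?_
  calc _ ≤ _ := add_le_add_left (mul_le_mul_right (W2_sq_le_cost hq) _) _
    _ ≤ _ := cost_interpolation_le π ht
    _ ≤ ENNReal.ofReal (1 - t) * ((ENNReal.ofReal t * D) ^ 2 + η)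
        + ENNReal.ofReal t * ((ENNReal.ofReal (1 - t) * D) ^ 2 + η) := by
      rw [← hW₀, ← hW₁]
      gcongr
    _ = ENNReal.ofReal t * ENNReal.ofReal (1 - t) * D ^ 2
          * (ENNReal.ofReal (1 - t) + ENNReal.ofReal t)
        + (ENNReal.ofReal (1 - t) + ENNReal.ofReal t) * η := by ring
    _ = _ := by rw [ht', ENNReal.ofReal_mul ht.1, mul_one, one_mul]

theorem ae_mem_closedBall_of_W2_eq {x : X} {ε R r t : ℝ} (ht : t ∈ Icc (0 : ℝ) 1)
    (hr : (1 + t) * ε + t * R < r) (h₀ : ∀ᵐ y ∂ν₀, y ∈ Metric.closedBall x ε)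
    (h₁ : ∀ᵐ y ∂ν₁, y ∈ Metric.closedBall x R) (hW : W2 ν₀ ν₁ ≠ ∞)
    (hW₀ : W2 ν₀ ν = ENNReal.ofReal t * W2 ν₀ ν₁)
    (hW₁ : W2 ν ν₁ = ENNReal.ofReal (1 - t) * W2 ν₀ ν₁) :
    ∀ᵐ y ∂ν, y ∈ Metric.closedBall x r := by
  set δ := r - ((1 + t) * ε + t * R)
  have hδ : 0 < δ := sub_pos.2 hr
  set E := (Metric.closedBall x r)ᶜ
  have hE : MeasurableSet E := Metric.isClosed_closedBall.measurableSet.compl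
  have key (η : ℝ≥0∞) (hη : 0 < η) : ENNReal.ofReal (δ ^ 2) * ν E ≤ η := by
    obtain ⟨π, hπ₁, hπ₂, hπ⟩ := exists_gluing_lintegral_sq_le ht hW hW₀ hW₁ hη.ne'
    have hfar : ∀ᵐ z ∂π, z.1 ∈ E →
        ENNReal.ofReal (δ ^ 2) ≤ ENNReal.ofReal ((dist z.2.1 z.1 - t * dist z.2.1 z.2.2) ^ 2) := by
      filter_upwards [ae_of_ae_map (by fun_prop) (hπ₁.ae_fst h₀),
        ae_of_ae_map (by fun_prop) (hπ₂.ae_snd h₁)] with ⟨y, x₀, x₁⟩ hx₀ hx₁ hy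
      have hy : r < dist y x := not_le.1 hy
      exact ENNReal.ofReal_le_ofReal (pow_le_pow_left₀ hδ.le
        (sub_le_dist_sub_mul_dist ht.1 hx₀ hx₁ hy.le) 2)
    have hν : π.map Prod.fst = ν := by
      rw [← hπ₂.1, Measure.map_map measurable_fst (by fun_prop)]
      rfl
    calc ENNReal.ofReal (δ ^ 2) * ν E = ENNReal.ofReal (δ ^ 2) * π {z | z.1 ∈ E} := by
          rw [← hν, Measure.map_apply measurable_fst hE]
          rfl
      _ ≤ ENNReal.ofReal (δ ^ 2) * π {z | ENNReal.ofReal (δ ^ 2)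
            ≤ ENNReal.ofReal ((dist z.2.1 z.1 - t * dist z.2.1 z.2.2) ^ 2)} := by
          gcongr 1
          exact measure_mono_ae hfar
      _ ≤ _ := mul_meas_ge_le_lintegral (by fun_prop) _
      _ ≤ η := hπ
  have h0 : ENNReal.ofReal (δ ^ 2) * ν E = 0 :=
    nonpos_iff_eq_zero.1 (le_of_forall_gt_imp_ge_of_dense key)
  exact (mul_eq_zero.1 h0).resolve_left (ENNReal.ofReal_pos.2 (by positivity)).ne'

end Transport

/-! ### The curvature-dimension condition -/

section CurvatureDimension

theorem negRenyi_le_measure_rpow {X : Type*} [MeasurableSpace X] {μ ν : Measure X}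
    [SigmaFinite μ] [IsProbabilityMeasure ν] (hac : ν ≪ μ) {N : ℝ} (hN : 1 ≤ N) {B : Set X}
    (hB : MeasurableSet B) (hνB : ∀ᵐ x ∂ν, x ∈ B) : negRenyi N ν μ ≤ μ B ^ (1 / N) := by
  have hN0 : 0 < N := by linarith
  have hN1 : 1 / N ≤ 1 := (div_le_one hN0).2 hN
  calc negRenyi N ν μ = ∫⁻ x, B.indicator (fun x => ν.rnDeriv μ x ^ (-1 / N)) x ∂ν := by
        refine lintegral_congr_ae ?_
        filter_upwards [hνB] with x hx
        rw [indicator_of_mem hx]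
    _ = ∫⁻ x, ν.rnDeriv μ x * B.indicator (fun x => ν.rnDeriv μ x ^ (-1 / N)) x ∂μ := by
        rw [lintegral_rnDeriv_mul hac]
        exact (((Measure.measurable_rnDeriv ν μ).pow_const _).indicator hB).aemeasurable
    _ ≤ ∫⁻ x, ν.rnDeriv μ x ^ (1 - 1 / N) * B.indicator 1 x ^ (1 / N) ∂μ := by
        refine lintegral_mono_ae ?_
        filter_upwards [Measure.rnDeriv_lt_top ν μ] with x hx
        by_cases hxB : x ∈ B
        · rw [indicator_of_mem hxB, indicator_of_mem hxB, Pi.one_apply, ENNReal.one_rpow, mul_one]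
          rcases eq_or_ne (ν.rnDeriv μ x) 0 with h0 | h0
          · rw [h0, zero_mul]
            exact zero_le
          · rw [sub_eq_add_neg, ENNReal.rpow_add _ _ h0 hx.ne, ENNReal.rpow_one, neg_div]
        · rw [indicator_of_notMem hxB, mul_zero]
          exact zero_le
    _ ≤ (∫⁻ x, ν.rnDeriv μ x ∂μ) ^ (1 - 1 / N) * (∫⁻ x, B.indicator 1 x ∂μ) ^ (1 / N) :=
        ENNReal.lintegral_mul_norm_pow_le (Measure.measurable_rnDeriv ν μ).aemeasurable
          (measurable_one.indicator hB).aemeasurable (by linarith) (by positivity) (by ring)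
    _ = μ B ^ (1 / N) := by
        rw [Measure.lintegral_rnDeriv hac, lintegral_indicator_one hB, measure_univ,
          ENNReal.one_rpow, one_mul]

theorem ae_rnDeriv_cond_withDensity {X : Type*} [MeasurableSpace X] {μ : Measure X}
    [SigmaFinite μ] {w : X → ℝ≥0∞} (hw : Measurable w) {A : Set X} (hA : MeasurableSet A) :
    ∀ᵐ y ∂ProbabilityTheory.cond (μ.withDensity w) A,
      (ProbabilityTheory.cond (μ.withDensity w) A).rnDeriv μ y
        = (∫⁻ z in A, w z ∂μ)⁻¹ * w y := by
  have hcond : ProbabilityTheory.cond (μ.withDensity w) A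
      = μ.withDensity fun y => (∫⁻ z in A, w z ∂μ)⁻¹ * A.indicator w y := by
    rw [ProbabilityTheory.cond, withDensity_apply _ hA, restrict_withDensity hA,
      ← withDensity_indicator hA, ← withDensity_smul _ (hw.indicator hA)]
    rfl
  have hac : ProbabilityTheory.cond (μ.withDensity w) A ≪ μ :=
    hcond ▸ withDensity_absolutelyContinuous _ _
  have hrn := Measure.rnDeriv_withDensity μ ((hw.indicator hA).const_mul (∫⁻ z in A, w z ∂μ)⁻¹)
  rw [← hcond] at hrn
  filter_upwards [hac.ae_le hrn, ProbabilityTheory.ae_cond_mem hA] with y hy hyA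
  rw [hy, indicator_of_mem hyA]

theorem mul_rpow_le_mul_inv_mul_rpow {N : ℝ} (hN : 0 < N) {a c I τ : ℝ≥0∞} (ha₀ : a ≠ 0)
    (ha : a ≠ ∞) (hτ : c * a ≤ τ ^ N) : (c * I) ^ (1 / N) ≤ τ * (I⁻¹ * a) ^ (-1 / N) :=
  calc (c * I) ^ (1 / N) = (c * a * (I * a⁻¹)) ^ (1 / N) := by
        rw [mul_mul_mul_comm, ENNReal.mul_inv_cancel ha₀ ha, mul_one]
    _ ≤ (τ ^ N * (I * a⁻¹)) ^ (1 / N) := by gcongr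
    _ = τ * (I⁻¹ * a) ^ (-1 / N) := by
        rw [ENNReal.mul_rpow_of_nonneg _ _ (one_div_nonneg.2 hN.le), ← ENNReal.rpow_mul,
          mul_one_div_cancel hN.ne', ENNReal.rpow_one, neg_div, ENNReal.rpow_neg,
          ← ENNReal.inv_rpow, ENNReal.mul_inv (Or.inr ha) (Or.inr ha₀), inv_inv]

variable {X : Type*} [MetricSpace X] [MeasurableSpace X] {μ ν₀ ν₁ : Measure X}

theorem memP2_of_ae_mem_closedBall [IsProbabilityMeasure ν₀] (hac : ν₀ ≪ μ) {x : X} {r : ℝ}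
    (h : ∀ᵐ y ∂ν₀, y ∈ Metric.closedBall x r) : MemP2 μ ν₀ := by
  refine ⟨inferInstance, ⟨x, ?_⟩, hac⟩
  calc ∫⁻ y, edist x y ^ 2 ∂ν₀ ≤ ∫⁻ _, ENNReal.ofReal r ^ 2 ∂ν₀ := by
        refine lintegral_mono_ae ?_
        filter_upwards [h] with y hy
        rw [edist_dist, dist_comm]
        gcongr
        exact hy
    _ < ∞ := by simp

theorem IsCoupling.W2_ne_top_of_ae_mem_closedBall [IsProbabilityMeasure ν₀]
    {q : Measure (X × X)} (hq : IsCoupling q ν₀ ν₁) {x : X} {r R : ℝ}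
    (h₀ : ∀ᵐ y ∂ν₀, y ∈ Metric.closedBall x r) (h₁ : ∀ᵐ y ∂ν₁, y ∈ Metric.closedBall x R) :
    W2 ν₀ ν₁ ≠ ∞ := by
  have := hq.isProbabilityMeasure
  have hcost : cost q < ∞ := by
    calc cost q ≤ ∫⁻ _, ENNReal.ofReal (r + R) ^ 2 ∂q := by
          refine lintegral_mono_ae ?_
          filter_upwards [hq.ae_fst h₀, hq.ae_snd h₁] with p hp₀ hp₁
          rw [edist_dist]
          gcongr
          exact (dist_triangle_right p.1 p.2 x).trans (add_le_add hp₀ hp₁)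
      _ < ∞ := by simp
  exact fun h => by simpa [h] using (W2_sq_le_cost hq).trans_lt hcost

variable [BorelSpace X] [SecondCountableTopology X] [StandardBorelSpace X] [SigmaFinite μ]

theorem CD.exists_isCoupling_lintegral_tau_le {κ N : ℝ} (hCD : CD κ N μ) (hN : 1 ≤ N)
    [IsProbabilityMeasure ν₀] [IsProbabilityMeasure ν₁] (h₀μ : ν₀ ≪ μ) (h₁μ : ν₁ ≪ μ)
    {x : X} {ε R r t : ℝ} (h₀ : ∀ᵐ y ∂ν₀, y ∈ Metric.closedBall x ε)
    (h₁ : ∀ᵐ y ∂ν₁, y ∈ Metric.closedBall x R) (ht : t ∈ Icc (0 : ℝ) 1)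
    (hr : (1 + t) * ε + t * R < r) :
    ∃ q, IsCoupling q ν₀ ν₁ ∧
      ∫⁻ p, tau κ N t (dist p.1 p.2) * ν₁.rnDeriv μ p.2 ^ (-1 / N) ∂q
        ≤ μ (Metric.closedBall x r) ^ (1 / N) := by
  obtain ⟨q, Γ, ⟨hq, -⟩, ⟨hΓ₀, hΓ₁, hΓ, hΓW⟩, hconv⟩ := hCD ν₀ ν₁
    (memP2_of_ae_mem_closedBall h₀μ h₀) (memP2_of_ae_mem_closedBall h₁μ h₁)
  have : IsProbabilityMeasure (Γ t) := (hΓ t ht).1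
  have hW₀ : W2 ν₀ (Γ t) = ENNReal.ofReal t * W2 ν₀ ν₁ := by
    have h := hΓW 0 (left_mem_Icc.2 zero_le_one) t ht
    rwa [hΓ₀, zero_sub, abs_neg, abs_of_nonneg ht.1] at h
  have hW₁ : W2 (Γ t) ν₁ = ENNReal.ofReal (1 - t) * W2 ν₀ ν₁ := by
    have h := hΓW t ht 1 (right_mem_Icc.2 zero_le_one)
    rwa [hΓ₁, abs_sub_comm, abs_of_nonneg (sub_nonneg.2 ht.2)] at h
  have hΓt := ae_mem_closedBall_of_W2_eq ht hr h₀ h₁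
    (hq.W2_ne_top_of_ae_mem_closedBall h₀ h₁) hW₀ hW₁
  refine ⟨q, hq, ?_⟩
  calc _ ≤ _ := lintegral_mono fun p => le_add_self
    _ ≤ negRenyi N (Γ t) μ := hconv t ht N le_rfl
    _ ≤ _ := negRenyi_le_measure_rpow (hΓ t ht).2.2 hN Metric.isClosed_closedBall.measurableSet hΓt

theorem CD.mul_setLIntegral_le_measure_closedBall {κ N : ℝ} (hCD : CD κ N μ) (hN : 1 ≤ N)
    {x : X} {ε R r t : ℝ} (hε₀ : μ (Metric.closedBall x ε) ≠ 0)
    (hε : μ (Metric.closedBall x ε) ≠ ∞) (ht : t ∈ Icc (0 : ℝ) 1)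
    (hr : (1 + t) * ε + t * R < r) {A : Set X} (hA : MeasurableSet A)
    (hAR : A ⊆ Metric.closedBall x R) {w : X → ℝ≥0∞} (hw : Measurable w)
    (hw₀ : ∀ y ∈ A, w y ≠ 0) (hw_top : ∀ y ∈ A, w y ≠ ∞) (hI : ∫⁻ y in A, w y ∂μ ≠ ∞) {c : ℝ≥0∞}
    (hτ : ∀ p ∈ Metric.closedBall x ε, ∀ y ∈ A, c * w y ≤ tau κ N t (dist p y) ^ N) :
    c * ∫⁻ y in A, w y ∂μ ≤ μ (Metric.closedBall x r) := by
  have hN0 : 0 < N := by linarith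
  set I := ∫⁻ y in A, w y ∂μ
  rcases eq_or_ne I 0 with hI₀ | hI₀
  · simp [hI₀]
  have hwA : μ.withDensity w A = I := withDensity_apply _ hA
  have hB : MeasurableSet (Metric.closedBall x ε) := Metric.isClosed_closedBall.measurableSet
  set ν₀ := ProbabilityTheory.cond μ (Metric.closedBall x ε)
  set ν₁ := ProbabilityTheory.cond (μ.withDensity w) A
  have : IsProbabilityMeasure ν₀ := ProbabilityTheory.cond_isProbabilityMeasure_of_finite hε₀ hε
  have : IsProbabilityMeasure ν₁ :=
    ProbabilityTheory.cond_isProbabilityMeasure_of_finite (hwA ▸ hI₀) (hwA ▸ hI)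
  have hν₀ : ∀ᵐ y ∂ν₀, y ∈ Metric.closedBall x ε := ProbabilityTheory.ae_cond_mem hB
  have hν₁ : ∀ᵐ y ∂ν₁, y ∈ A := ProbabilityTheory.ae_cond_mem hA
  obtain ⟨q, hq, hqr⟩ := hCD.exists_isCoupling_lintegral_tau_le hN
    ProbabilityTheory.cond_absolutelyContinuous
    (ProbabilityTheory.cond_absolutelyContinuous.trans (withDensity_absolutelyContinuous μ w))
    hν₀ (hν₁.mono hAR) ht hr
  have := hq.isProbabilityMeasure
  refine (ENNReal.rpow_le_rpow_iff (one_div_pos.2 hN0)).1 (le_trans ?_ hqr)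
  calc (c * I) ^ (1 / N) = ∫⁻ _, (c * I) ^ (1 / N) ∂q := by simp
    _ ≤ _ := lintegral_mono_ae ?_
  filter_upwards [hq.ae_fst hν₀, hq.ae_snd (hν₁.and (ae_rnDeriv_cond_withDensity hw hA))]
    with p hp₀ ⟨hp₁, hρ⟩
  rw [hρ]
  exact mul_rpow_le_mul_inv_mul_rpow hN0 (hw₀ _ hp₁) (hw_top _ hp₁) (hτ p.1 hp₀ p.2 hp₁)

theorem CD.ofReal_mul_setLIntegral_le_measure_closedBall {κ N : ℝ} (hCD : CD κ N μ)
    (hN : 2 ≤ N) (hκ : 0 ≤ κ) {x : X} {ε R r t : ℝ} (hε : 0 ≤ ε)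
    (hμε₀ : μ (Metric.closedBall x ε) ≠ 0) (hμε : μ (Metric.closedBall x ε) ≠ ∞) (ht : 0 < t)
    (ht' : 2 * t ^ 2 ≤ 1) (hr : (1 + t) * ε + t * R < r) {A : Set X} (hA : MeasurableSet A)
    (hAR : A ⊆ Metric.closedBall x R) (hμA : μ A ≠ ∞) :
    ENNReal.ofReal (t ^ N * (1 - 2 * t ^ 2) ^ (N - 1) * (1 - κ * ε * R / 3))
        * ∫⁻ y in A, ENNReal.ofReal (1 + κ * dist y x ^ 2 / 6) ∂μ
      ≤ μ (Metric.closedBall x r) := by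
  have hI : ∫⁻ y in A, ENNReal.ofReal (1 + κ * dist y x ^ 2 / 6) ∂μ ≠ ∞ := by
    refine (setLIntegral_lt_top_of_le_nnreal hμA
      ⟨(1 + κ * R ^ 2 / 6).toNNReal, fun y hy => ENNReal.ofReal_le_ofReal ?_⟩).ne
    have hyR : dist y x ≤ R := hAR hy
    gcongr
  refine hCD.mul_setLIntegral_le_measure_closedBall (one_le_two.trans hN) hμε₀ hμε
    ⟨ht.le, by nlinarith⟩ hr hA hAR (by fun_prop)
    (fun y _ => (ENNReal.ofReal_pos.2 (by positivity)).ne') (fun _ _ => ENNReal.ofReal_ne_top) hI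
    fun p hp y hy => ?_
  have hyp : dist y x ≤ dist p y + ε :=
    (dist_triangle_left y x p).trans (add_le_add_right hp _)
  exact ofReal_mul_ofReal_le_tau_rpow hN hκ ht ht' dist_nonneg dist_nonneg hε hyp (hAR hy)

end CurvatureDimension

/-! ### Volume comparison with Euclidean balls -/

section Infinitesimal

variable {X : Type*} [MetricSpace X] [MeasurableSpace X] {μ : Measure X} {n : ℕ}

theorem NDimensional.eventually_measure_closedBall_ne_zero_ne_top (hdim : NDimensional n μ)
    (x : X) :
    ∀ᶠ r in 𝓝[>] (0 : ℝ), μ (Metric.closedBall x r) ≠ 0 ∧ μ (Metric.closedBall x r) ≠ ∞ := by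
  filter_upwards [hdim x (Ioo_mem_nhds zero_lt_one ENNReal.one_lt_top)] with r hr
  obtain ⟨hpos, hlt⟩ : 0 < μ (Metric.closedBall x r) / euclideanBallVol n r ∧
      μ (Metric.closedBall x r) / euclideanBallVol n r < ∞ := hr
  exact ⟨(ENNReal.div_pos_iff.1 hpos).1,
    fun h => hlt.ne (ENNReal.div_eq_top.2 (Or.inr ⟨h, (euclideanBallVol_lt_top n r).ne⟩))⟩

theorem NDimensional.isLocallyFiniteMeasure (hdim : NDimensional n μ) :
    IsLocallyFiniteMeasure μ := by
  refine ⟨fun x => ?_⟩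
  obtain ⟨r, ⟨-, hr⟩, hr₀⟩ :=
    ((hdim.eventually_measure_closedBall_ne_zero_ne_top x).and self_mem_nhdsWithin).exists
  exact ⟨_, Metric.closedBall_mem_nhds x hr₀, hr.lt_top⟩

theorem NDimensional.tendsto_measure_closedBall_div (hdim : NDimensional n μ) (x : X)
    {ρ : ℝ → ℝ} {R : ℝ} (hR : 0 < R) (hρ : Tendsto ρ (𝓝[>] 0) (𝓝 R)) :
    Tendsto (fun t => μ (Metric.closedBall x (t * ρ t)) / ENNReal.ofReal (t ^ n))
      (𝓝[>] 0) (𝓝 (euclideanBallVol n R)) := by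
  have hρ_pos : ∀ᶠ t in 𝓝[>] (0 : ℝ), 0 < ρ t := hρ.eventually_const_lt hR
  have hzero : Tendsto (fun t => t * ρ t) (𝓝[>] 0) (𝓝[>] 0) := by
    refine tendsto_nhdsWithin_iff.2 ⟨?_, ?_⟩
    · have hid : Tendsto (fun t : ℝ => t) (𝓝[>] 0) (𝓝 0) :=
        tendsto_nhdsWithin_of_tendsto_nhds tendsto_id
      simpa only [zero_mul] using hid.mul hρ
    · filter_upwards [hρ_pos, self_mem_nhdsWithin] with t hρt ht
      exact mul_pos ht hρt
  have hlim := ENNReal.Tendsto.mul ((hdim x).comp hzero) (Or.inl one_ne_zero)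
    ((tendsto_euclideanBallVol n hR).comp hρ) (Or.inr ENNReal.one_ne_top)
  rw [one_mul] at hlim
  refine hlim.congr' ?_
  filter_upwards [hρ_pos, self_mem_nhdsWithin] with t hρt ht
  have ht : 0 < t := ht
  have hV₀ := (euclideanBallVol_pos n hρt).ne'
  have hV := (euclideanBallVol_lt_top n (ρ t)).ne
  simp only [Function.comp_apply]
  rw [euclideanBallVol_mul n ht.le hρt.le, ← ENNReal.mul_div_right_comm,
    ENNReal.mul_div_mul_right _ _ hV₀ hV]

variable [BorelSpace X] [SecondCountableTopology X] [StandardBorelSpace X] {κ : ℝ}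

-- Contraction by the factor `t` towards the ball of radius `t²`, in the limit `t → 0`.
theorem CD.setLIntegral_le_euclideanBallVol_of_ne_top (hCD : CD κ n μ) (hn : 2 ≤ n)
    (hκ : 0 ≤ κ) (hdim : NDimensional n μ) {x : X} {R : ℝ} (hR : 0 < R) {A : Set X}
    (hA : MeasurableSet A) (hAR : A ⊆ Metric.closedBall x R) (hμA : μ A ≠ ∞) :
    ∫⁻ y in A, ENNReal.ofReal (1 + κ * dist y x ^ 2 / 6) ∂μ ≤ euclideanBallVol n R := by
  have := hdim.isLocallyFiniteMeasure
  set I := ∫⁻ y in A, ENNReal.ofReal (1 + κ * dist y x ^ 2 / 6) ∂μ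
  have hid : Tendsto (fun t : ℝ => t) (𝓝[>] 0) (𝓝 0) :=
    tendsto_nhdsWithin_of_tendsto_nhds tendsto_id
  have hρ : Tendsto (fun t => R + 3 * t) (𝓝[>] 0) (𝓝 R) := by
    simpa using (hid.const_mul 3).const_add R
  have hfactor : Tendsto (fun t : ℝ => ENNReal.ofReal
      ((1 - 2 * t ^ 2) ^ ((n : ℝ) - 1) * (1 - κ * t ^ 2 * R / 3)) * I) (𝓝[>] 0) (𝓝 I) := by
    have hbase : ContinuousAt (fun t : ℝ => (1 - 2 * t ^ 2) ^ ((n : ℝ) - 1)) 0 :=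
      ContinuousAt.rpow_const (by fun_prop) (Or.inl (by norm_num))
    have hreal := (hbase.mul (g := fun t => 1 - κ * t ^ 2 * R / 3) (by fun_prop)).tendsto.mono_left
      (nhdsWithin_le_nhds (s := Ioi 0))
    simpa using ENNReal.Tendsto.mul_const (b := I) (ENNReal.tendsto_ofReal hreal)
      (Or.inl (by simp))
  refine le_of_tendsto_of_tendsto hfactor (hdim.tendsto_measure_closedBall_div x hR hρ) ?_
  have hsq : Tendsto (fun t : ℝ => t ^ 2) (𝓝[>] 0) (𝓝[>] 0) :=
    tendsto_nhdsWithin_iff.2 ⟨by simpa using hid.pow 2,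
      eventually_nhdsWithin_of_forall fun _ ht => mem_Ioi.2 (pow_pos (mem_Ioi.1 ht) 2)⟩
  filter_upwards [self_mem_nhdsWithin, hid.eventually_lt_const one_half_pos,
    hsq.eventually (hdim.eventually_measure_closedBall_ne_zero_ne_top x)] with t ht ht' ⟨hμ₀, hμ⟩
  have ht : 0 < t := ht
  rw [ENNReal.le_div_iff_mul_le (Or.inl (ENNReal.ofReal_pos.2 (by positivity)).ne')
    (Or.inl ENNReal.ofReal_ne_top), mul_right_comm, ← ENNReal.ofReal_mul' (by positivity)]
  convert hCD.ofReal_mul_setLIntegral_le_measure_closedBall (r := t * (R + 3 * t))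
    (by exact_mod_cast hn) hκ (sq_nonneg t) hμ₀ hμ ht (by nlinarith)
    (by nlinarith [pow_pos ht 2]) hA hAR hμA using 3
  rw [Real.rpow_natCast]
  ring

theorem measure_le_setLIntegral_one_add {Y : Type*} [PseudoMetricSpace Y] [MeasurableSpace Y]
    (ν : Measure Y) (hκ : 0 ≤ κ) (x : Y) (A : Set Y) :
    ν A ≤ ∫⁻ y in A, ENNReal.ofReal (1 + κ * dist y x ^ 2 / 6) ∂ν :=
  calc ν A = ∫⁻ _ in A, 1 ∂ν := by simp
    _ ≤ _ := lintegral_mono fun y =>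
      ENNReal.one_le_ofReal.2 (le_add_of_nonneg_right (by positivity))

theorem CD.setLIntegral_closedBall_le_euclideanBallVol (hCD : CD κ n μ) (hn : 2 ≤ n)
    (hκ : 0 ≤ κ) (hdim : NDimensional n μ) (x : X) {R : ℝ} (hR : 0 < R) :
    ∫⁻ y in Metric.closedBall x R, ENNReal.ofReal (1 + κ * dist y x ^ 2 / 6) ∂μ
      ≤ euclideanBallVol n R := by
  have := hdim.isLocallyFiniteMeasure
  have hB : MeasurableSet (Metric.closedBall x R) := Metric.isClosed_closedBall.measurableSet
  refine hCD.setLIntegral_le_euclideanBallVol_of_ne_top hn hκ hdim hR hB subset_rfl fun htop => ?_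
  obtain ⟨A, hA, hAR, hVA, hμA⟩ := Measure.exists_subset_measure_lt_top (μ := μ) hB
    (r := euclideanBallVol n R) (htop ▸ euclideanBallVol_lt_top n R)
  exact hVA.not_ge ((measure_le_setLIntegral_one_add μ hκ x A).trans
    (hCD.setLIntegral_le_euclideanBallVol_of_ne_top hn hκ hdim hR hA hAR hμA.ne))

theorem CD.measure_closedBall_le_euclideanBallVol (hCD : CD κ n μ) (hn : 2 ≤ n) (hκ : 0 ≤ κ)
    (hdim : NDimensional n μ) (x : X) {R : ℝ} (hR : 0 < R) :
    μ (Metric.closedBall x R) ≤ euclideanBallVol n R :=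
  (measure_le_setLIntegral_one_add μ hκ x _).trans
    (hCD.setLIntegral_closedBall_le_euclideanBallVol hn hκ hdim x hR)

end Infinitesimal

section SecondOrder

theorem lintegral_sq_sub_dist_sq_eq {X : Type*} [PseudoMetricSpace X] [MeasurableSpace X]
    [OpensMeasurableSpace X] (μ : Measure X) (x : X) (R : ℝ) :
    ∫⁻ z, ENNReal.ofReal (R ^ 2 - dist z x ^ 2) ∂μ
      = ∫⁻ s in Ioi (0 : ℝ), μ (Metric.ball x (√(R ^ 2 - s))) := by
  have hcake := lintegral_eq_lintegral_meas_lt μ (f := fun z => max (R ^ 2 - dist z x ^ 2) 0)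
    (Eventually.of_forall fun _ => le_max_right _ _) (by fun_prop)
  simp only [ENNReal.ofReal_max, ENNReal.ofReal_zero, max_eq_left zero_le] at hcake
  rw [hcake]
  refine setLIntegral_congr_fun measurableSet_Ioi fun s hs => congrArg μ (Set.ext fun z => ?_)
  rw [mem_ofPred_eq, lt_max_iff, or_iff_left (not_lt.2 (mem_Ioi.1 hs).le), Metric.mem_ball,
    Real.lt_sqrt dist_nonneg, lt_sub_comm]

theorem lintegral_sq_sub_dist_sq_mono {X Y : Type*} [PseudoMetricSpace X] [MeasurableSpace X]
    [OpensMeasurableSpace X] [PseudoMetricSpace Y] [MeasurableSpace Y] [OpensMeasurableSpace Y]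
    {μ : Measure X} {ν : Measure Y} {x : X} {y : Y}
    (h : ∀ r > 0, μ (Metric.ball x r) ≤ ν (Metric.ball y r)) (R : ℝ) :
    ∫⁻ z, ENNReal.ofReal (R ^ 2 - dist z x ^ 2) ∂μ
      ≤ ∫⁻ z, ENNReal.ofReal (R ^ 2 - dist z y ^ 2) ∂ν := by
  rw [lintegral_sq_sub_dist_sq_eq, lintegral_sq_sub_dist_sq_eq]
  refine lintegral_mono fun s => ?_
  rcases (Real.sqrt_nonneg (R ^ 2 - s)).eq_or_lt with h0 | h0
  · simp [← h0]
  · exact h _ h0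

theorem lintegral_sq_sub_dist_sq_euclideanSpace {n : ℕ} (hn : 0 < n)
    (y : EuclideanSpace ℝ (Fin n)) {R : ℝ} (hR : 0 ≤ R) :
    ∫⁻ z, ENNReal.ofReal (R ^ 2 - dist z y ^ 2)
      = ENNReal.ofReal (2 * R ^ 2 / (n + 2)) * euclideanBallVol n R := by
  have hpi : ENNReal.ofReal Real.pi ≠ 0 := (ENNReal.ofReal_pos.2 Real.pi_pos).ne'
  have hsupp : (Function.support fun z => ENNReal.ofReal (R ^ 2 - dist z y ^ 2))
      ⊆ Metric.closedBall y R := fun z hz =>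
    le_of_sq_le_sq (sub_pos.1 (ENNReal.ofReal_pos.1 (pos_iff_ne_zero.2 hz))).le hR
  rw [← ENNReal.mul_right_inj hpi ENNReal.ofReal_ne_top]
  calc ENNReal.ofReal Real.pi * ∫⁻ z, ENNReal.ofReal (R ^ 2 - dist z y ^ 2)
      = ∫⁻ z in Metric.closedBall y R, ENNReal.ofReal (Real.pi * (R ^ 2 - dist z y ^ 2)) := by
        simp only [ENNReal.ofReal_mul Real.pi_pos.le]
        rw [lintegral_const_mul _ (by fun_prop), setLIntegral_eq_of_support_subset hsupp]
    _ = ENNReal.ofReal (2 * Real.pi * R ^ 2 / (n + 2)) * euclideanBallVol n R := by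
        rw [lintegral_pi_mul_sq_sub_dist_sq y hR, euclideanBallVol_add_two hn hR]
    _ = _ := by
        rw [← mul_assoc, ← ENNReal.ofReal_mul Real.pi_pos.le]
        congr 2
        ring

variable {X : Type*} [MetricSpace X] [MeasurableSpace X] [BorelSpace X]
  [SecondCountableTopology X] [StandardBorelSpace X] {μ : Measure X} {n : ℕ} {κ : ℝ}

theorem CD.lintegral_sq_sub_dist_sq_le (hCD : CD κ n μ) (hn : 2 ≤ n) (hκ : 0 ≤ κ)
    (hdim : NDimensional n μ) (x : X) {R : ℝ} (hR : 0 ≤ R) :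
    ∫⁻ z, ENNReal.ofReal (R ^ 2 - dist z x ^ 2) ∂μ
      ≤ ENNReal.ofReal (2 * R ^ 2 / (n + 2)) * euclideanBallVol n R := by
  have : Nontrivial (EuclideanSpace ℝ (Fin n)) :=
    Module.nontrivial_of_finrank_pos (R := ℝ) (by rw [finrank_euclideanSpace_fin]; lia)
  rw [← lintegral_sq_sub_dist_sq_euclideanSpace (by lia) 0 hR]
  refine lintegral_sq_sub_dist_sq_mono (fun r hr => ?_) R
  rw [← Measure.addHaar_closedBall_eq_addHaar_ball]
  exact (measure_mono Metric.ball_subset_closedBall).trans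
    (hCD.measure_closedBall_le_euclideanBallVol hn hκ hdim x hr)

theorem CD.mul_measure_closedBall_le_euclideanBallVol (hCD : CD κ n μ) (hn : 2 ≤ n)
    (hκ : 0 ≤ κ) (hdim : NDimensional n μ) (x : X) {R : ℝ} (hR : 0 < R) :
    ENNReal.ofReal (1 + κ * R ^ 2 / 6) * μ (Metric.closedBall x R)
      ≤ ENNReal.ofReal (1 + κ * R ^ 2 / (3 * (n + 2))) * euclideanBallVol n R :=
  calc _ = ∫⁻ _ in Metric.closedBall x R, ENNReal.ofReal (1 + κ * R ^ 2 / 6) ∂μ := by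
        rw [setLIntegral_const]
    _ ≤ ∫⁻ y in Metric.closedBall x R, (ENNReal.ofReal (1 + κ * dist y x ^ 2 / 6)
        + ENNReal.ofReal (κ / 6) * ENNReal.ofReal (R ^ 2 - dist y x ^ 2)) ∂μ := by
        refine lintegral_mono fun y => ?_
        rw [← ENNReal.ofReal_mul (by positivity)]
        exact (ENNReal.ofReal_le_ofReal (by linarith)).trans ENNReal.ofReal_add_le
    _ = (∫⁻ y in Metric.closedBall x R, ENNReal.ofReal (1 + κ * dist y x ^ 2 / 6) ∂μ)
        + ENNReal.ofReal (κ / 6)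
          * ∫⁻ y in Metric.closedBall x R, ENNReal.ofReal (R ^ 2 - dist y x ^ 2) ∂μ := by
        rw [lintegral_add_left (by fun_prop), lintegral_const_mul _ (by fun_prop)]
    _ ≤ euclideanBallVol n R + ENNReal.ofReal (κ / 6)
          * (ENNReal.ofReal (2 * R ^ 2 / (n + 2)) * euclideanBallVol n R) := by
        gcongr
        · exact hCD.setLIntegral_closedBall_le_euclideanBallVol hn hκ hdim x hR
        · exact (setLIntegral_le_lintegral _ _).trans
            (hCD.lintegral_sq_sub_dist_sq_le hn hκ hdim x hR.le)
    _ = _ := by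
        rw [ENNReal.ofReal_add zero_le_one (by positivity), ENNReal.ofReal_one, add_mul, one_mul,
          ← mul_assoc, ← ENNReal.ofReal_mul (by positivity)]
        congr 3
        field_simp
        ring

theorem one_add_lt_mul_one_sub {n κ γ ε : ℝ} (hn : 0 ≤ n) (hγ : 0 < γ) (hε : 0 < ε)
    (h : κ * ε ^ 2 / 6 < n * κ * γ ^ 2 / 2 - 1) :
    1 + κ * ε ^ 2 / (3 * (n + 2))
      < (1 + κ * ε ^ 2 / 6) * (1 - ε ^ 2 / (3 * γ ^ 2 * (n + 2))) := by
  have hdiff : (1 + κ * ε ^ 2 / 6) * (1 - ε ^ 2 / (3 * γ ^ 2 * (n + 2)))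
      - (1 + κ * ε ^ 2 / (3 * (n + 2)))
      = ε ^ 2 / (3 * γ ^ 2 * (n + 2)) * (n * κ * γ ^ 2 / 2 - 1 - κ * ε ^ 2 / 6) := by
    field_simp
    ring
  exact sub_pos.1 (hdiff ▸ mul_pos (by positivity) (sub_pos.2 h))

theorem CD.measure_closedBall_lt_volSE_ballSE (hCD : CD κ n μ) (hn : 2 ≤ n) (hκ : 0 ≤ κ)
    (hdim : NDimensional n μ) {γ ε : ℝ} (hγ : 0 < γ) (hε : 0 < ε) (hεγ : ε ≤ γ)
    (hεκ : κ * ε ^ 2 / 6 < n * κ * γ ^ 2 / 2 - 1) (x : X)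
    (y : S2 × EuclideanSpace ℝ (Fin (n - 2))) :
    μ (Metric.closedBall x ε) < volSE γ (n - 2) (ballSE γ y ε) := by
  have hεπ : ε < γ * (Real.pi / 2) := by nlinarith [Real.pi_gt_three]
  have ha : 0 < 1 + κ * ε ^ 2 / 6 := by positivity
  have harith := one_add_lt_mul_one_sub n.cast_nonneg hγ hε hεκ
  refine lt_of_lt_of_le ?_ (ofReal_mul_euclideanBallVol_le_volSE hn hγ hε.le hεπ y)
  refine (ENNReal.mul_lt_mul_iff_right (ENNReal.ofReal_pos.2 ha).ne' ENNReal.ofReal_ne_top).1 ?_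
  calc ENNReal.ofReal (1 + κ * ε ^ 2 / 6) * μ (Metric.closedBall x ε)
      ≤ ENNReal.ofReal (1 + κ * ε ^ 2 / (3 * (n + 2))) * euclideanBallVol n ε :=
        hCD.mul_measure_closedBall_le_euclideanBallVol hn hκ hdim x hε
    _ < ENNReal.ofReal ((1 + κ * ε ^ 2 / 6) * (1 - ε ^ 2 / (3 * γ ^ 2 * (n + 2))))
          * euclideanBallVol n ε :=
        (ENNReal.mul_lt_mul_iff_left (euclideanBallVol_pos n hε).ne'
          (euclideanBallVol_lt_top n ε).ne).2
          ((ENNReal.ofReal_lt_ofReal_iff (lt_trans (by positivity) harith)).2 harith)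
    _ = _ := by rw [ENNReal.ofReal_mul ha.le, mul_assoc]

end SecondOrder

end VolumicScalar

end

theorem theorem1p1_general {X : Type*} [MetricSpace X] [SecondCountableTopology X]
    [MeasurableSpace X] [BorelSpace X] [StandardBorelSpace X] {μ : Measure X} {n : ℕ}
    (hn : 2 ≤ n) {κ : ℝ} (hκ : 0 ≤ κ) (hdim : VolumicScalar.NDimensional n μ)
    (hCD : VolumicScalar.CD κ (n : ℝ) μ) :
    VolumicScalar.VolScalGE n ((n : ℝ) * κ) μ := by
  rcases hκ.eq_or_lt with rfl | hκ₀
  · exact Or.inl ⟨mul_zero _, 1, one_pos, fun ε hε _ x =>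
      hCD.measure_closedBall_le_euclideanBallVol hn le_rfl hdim x hε⟩
  refine Or.inr ⟨by positivity, fun γ hγ => ?_⟩
  have hγ₀ : 0 < γ := (Real.sqrt_nonneg _).trans_lt hγ
  have hδ : 0 < n * κ * γ ^ 2 / 2 - 1 := by
    rw [Real.sqrt_lt' hγ₀, div_lt_iff₀ (by positivity)] at hγ
    linarith
  set δ := n * κ * γ ^ 2 / 2 - 1
  refine ⟨min γ (√(3 * δ / κ)), lt_min hγ₀ (Real.sqrt_pos.2 (by positivity)),
    fun ε hε hεr => hCD.measure_closedBall_lt_volSE_ballSE hn hκ hdim hγ₀ hε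
      (hεr.trans (min_le_left _ _)) ?_⟩
  have hεδ := (Real.le_sqrt' hε).1 (hεr.trans (min_le_right _ _))
  rw [le_div_iff₀ hκ₀] at hεδ
  change κ * ε ^ 2 / 6 < δ
  linarith

theorem theorem1p1 {X : Type*} [MetricSpace X] [CompleteSpace X]
    [TopologicalSpace.SeparableSpace X] [MeasurableSpace X] [BorelSpace X]
    (hX : VolumicScalar.IsLengthMetric X)
    (μ : Measure X) [IsLocallyFiniteMeasure μ] [μ.IsOpenPosMeasure]
    (n : ℕ) (hn : 2 ≤ n) (κ : ℝ) (hκ : 0 ≤ κ)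
    (hdim : VolumicScalar.NDimensional n μ)
    (hCD : VolumicScalar.CD κ (n : ℝ) μ) :
    VolumicScalar.VolScalGE n ((n : ℝ) * κ) μ := by
  have : SecondCountableTopology X := UniformSpace.secondCountable_of_separable X
  exact theorem1p1_general hn hκ hdim hCD
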